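/- **Theorem 4.5.** Let $d\in\mathbb N$, $d\ge 1$, and $s>1$. Let $\mathbb T=\mathbb R/2\pi\mathbb Z$, and for $f\in L_1(\mathbb T^d)$ and $k\in\mathbb Z^d$ put $\hat f(k)=(2\pi)^{-d}\int_{\mathbb T^d}f(x)e^{-ikx}\,dx$. Let $H^{s,2}_{\rm mix}(\mathbb T^d)$, $\mathcal A^{s,2}_{\rm mix}(\mathbb T^d)$ and $H^1(\mathbb T^d)$ be the spaces of all $f\in L_1(\mathbb T^d)$ for which, respectively, the norm $$\|f\|_{H^{s,2}_{\rm mix}}=\Big(\sum_{k\in\mathbb Z^d}\prod_{j=1}^d(1+|k_j|^2)^{s}\,|\hat f(k)|^2\Big)^{1/2},\qquad \|f\|_{\mathcal A^{s,2}_{\rm mix}}=\sum_{k\in\mathbb Z^d}\prod_{j=1}^d(1+|k_j|^2)^{s/2}\,|\hat f(k)|,\qquad \|f\|_{H^1}=\Big(\sum_{k\in\mathbb Z^d}\Big(1+\sum_{j=1}^d|k_j|^2\Big)|\hat f(k)|^2\Big)^{1/2}$$ is finite. Let $\mathcal T^d=\{e^{ikx}:k\in\mathbb Z^d\}$, and for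 $X\in\{H^{s,2}_{\rm mix}(\mathbb T^d),\mathcal A^{s,2}_{\rm mix}(\mathbb T^d)\}$ and $n\in\mathbb N$ let $$\sigma_n\big(id:X\to H^1(\mathbb T^d),\mathcal T^d\big)=\sup_{\|f\|_X\le1}\ \inf_{\substack{a_1,\dots,a_n\in\mathbb C\\ y_1,\dots,y_n\in\mathcal T^d}}\Big\|f-\sum_{j=1}^n a_jy_j\Big\|_{H^1(\mathbb T^d)}$$ be the best $n$-term approximation width. Put $S=\sum_{k=1}^\infty (k^2+1)^{-\frac{s}{2(s-1)}}$. Then the series $S$ converges, all these widths are finite, and $$\lim_{n\to\infty}\frac{\sigma_n\big(id:H^{s,2}_{\rm mix}(\mathbb T^d)\to H^1(\mathbb T^d),\mathcal T^d\big)}{n^{1-s}}=\Big(\frac{s-1}{s-\frac12}\Big)^{s-1}(2d)^{s-1}(2S+1)^{(s-1)(d-1)},$$ $$\lim_{n\to\infty}\frac{\sigma_n\big(id:\mathcal A^{s,2}_{\rm mix}(\mathbb T^d)\to H^1(\mathbb T^d),\mathcal T^d\big)}{n^{\frac12-s}}=\frac{(s-\frac12)^{s-\frac12}}{\sqrt2\,s^{s-1}}(2d)^{s-1}(2S+1)^{(s-1)(d-1)}.$$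 -/

import Mathlib

open Real Filter Topology MeasureTheory
open scoped ENNReal

noncomputable section

namespace TrigApprox

/-- Best `n`-term approximation error `σ_n(f; 𝓓)` of `f` with respect to the dictionary `𝓓`, the
error being measured in the (extended) norm `NY`: the infimum of `NY (f - ∑_{j=1}^n a_j y_j)` over
complex coefficients `a_j` and elements `y_j` of `𝓓`. -/
def nTermError {E : Type*} [AddCommGroup E] [Module ℂ E] (NY : E → ℝ≥0∞) (𝓓 : Set E) (n : ℕ)
    (f : E) : ℝ≥0∞ :=
  ⨅ (a : Fin n → ℂ) (y : Fin n → 𝓓), NY (f - ∑ j, a j • (y j : E))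

/-- Best `n`-term approximation width `σ_n(id : X → Y; 𝓓)` of the identity, where the spaces
`X = {f | NX f < ∞}` and `Y = {f | NY f < ∞}` are given as subspaces of a common vector space `E` by
their norms, extended by the value `∞` outside the space: the supremum of the errors over the closed
unit ball of `X`. -/
def nTermWidth {E : Type*} [AddCommGroup E] [Module ℂ E] (NX NY : E → ℝ≥0∞) (𝓓 : Set E)
    (n : ℕ) : ℝ≥0∞ :=
  ⨆ (f : E) (_ : NX f ≤ 1), nTermError NY 𝓓 n f

instance factTwoPiPos : Fact (0 < 2 * π) := ⟨Real.two_pi_pos⟩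

/-- The `d`-dimensional torus `𝕋^d`, where `𝕋 = ℝ / 2πℤ`. -/
abbrev Torus (d : ℕ) : Type := Fin d → AddCircle (2 * π)

/-- The normalized Lebesgue measure `(2π)^{-d} dx` on `𝕋^d`, a probability measure. -/
abbrev torusMeasure (d : ℕ) : Measure (Torus d) :=
  Measure.pi fun _ => AddCircle.haarAddCircle

/-- The space `L_1(𝕋^d)` of (classes of) integrable complex functions. -/
abbrev TorusL1 (d : ℕ) : Type := Lp ℂ 1 (torusMeasure d)

/-- The function `x ↦ e^{ikx} = ∏_j e^{i k_j x_j}` on `𝕋^d` (Mathlib's `fourier m` on `ℝ / 2πℤ` is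
`x ↦ e^{i m x}`). -/
def trig {d : ℕ} (k : Fin d → ℤ) : C(Torus d, ℂ) where
  toFun x := ∏ j, fourier (k j) (x j)
  continuous_toFun := by fun_prop

/-- The trigonometric system `{e^{ikx} : k ∈ ℤ^d}`, as a subset of `L_1(𝕋^d)`. -/
def trigSystem (d : ℕ) : Set (TorusL1 d) :=
  Set.range fun k : Fin d → ℤ => ContinuousMap.toLp (E := ℂ) 1 (torusMeasure d) ℂ (trig k)

/-- The Fourier coefficient `(2π)^{-d} ∫ f(x) e^{-ikx} dx` of `f ∈ L_1(𝕋^d)`. -/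
def torusCoeff {d : ℕ} (f : TorusL1 d) (k : Fin d → ℤ) : ℂ :=
  ∫ x, f x * trig (-k) x ∂(torusMeasure d)

/-- The norm `(∑_k |ω(k) f̂(k)|^p)^{1/p}` of the weighted class `F_{ω,p}(𝕋^d)`, for a positive
weight `ω` and `0 < p < ∞`. It has the value `∞` exactly for the `f ∈ L_1(𝕋^d)` outside the class. -/
def weightedNorm {d : ℕ} (ω : (Fin d → ℤ) → ℝ) (p : ℝ) (f : TorusL1 d) : ℝ≥0∞ :=
  (∑' k : Fin d → ℤ, ENNReal.ofReal ((ω k * ‖torusCoeff f k‖) ^ p)) ^ (1 / p)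

/-- The weight `∏_j (1 + |k_j|^2)^{s/2}`. -/
def mixWeight {d : ℕ} (s : ℝ) (k : Fin d → ℤ) : ℝ :=
  ∏ j, (1 + (k j : ℝ) ^ 2) ^ (s / 2)

/-- The weight `(1 + ∑_j |k_j|^2)^{1/2}`. -/
def energyWeight {d : ℕ} (k : Fin d → ℤ) : ℝ :=
  (1 + ∑ j, (k j : ℝ) ^ 2) ^ (1 / 2 : ℝ)

/-- The norm of the periodic Sobolev space `H^{s,2}_mix(𝕋^d)` of mixed smoothness. -/
def hMixNorm (d : ℕ) (s : ℝ) : TorusL1 d → ℝ≥0∞ := weightedNorm (mixWeight s) 2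

/-- The norm of the weighted Wiener algebra `𝒜^{s,2}_mix(𝕋^d)`. -/
def aMixNorm (d : ℕ) (s : ℝ) : TorusL1 d → ℝ≥0∞ := weightedNorm (mixWeight s) 1

/-- The norm of the isotropic periodic Sobolev space `H^1(𝕋^d)`. -/
def hOneNorm (d : ℕ) : TorusL1 d → ℝ≥0∞ := weightedNorm energyWeight 2

/-- The terms `1 / (k^2 + 1)^{s / (2(s-1))}`, `k ≥ 1`, of the series `S`; the index is `i = k - 1`. -/
def sTerm (s : ℝ) (i : ℕ) : ℝ := 1 / (((i : ℝ) + 1) ^ 2 + 1) ^ (s / (2 * (s - 1)))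

/-- `S = ∑_{k ≥ 1} (k^2 + 1)^{-s / (2(s-1))}`. -/
def sSum (s : ℝ) : ℝ := ∑' i : ℕ, sTerm s i

end TrigApprox

end

namespace TrigApprox

/-! Both source spaces are weighted ℓ_p spaces of Fourier coefficients (p = 2 or p = 1) with weight
ω = `mixWeight s`, and the target is weighted ℓ_2 with weight η = `energyWeight`, so only the
quotient ω/η matters. Let W_m be the sum of the m smallest values of (ω/η)^p. Then σ_n^p = sup_{m>n}
(m-n)^{p/2} / W_m. For the lower bound (`le_nTermWidth`), let η|f̂| be constant on m frequencies: n
terms leave at least m-n of them untouched. For the upper bound (`nTermWidth_le`), remove the n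
largest values of η|f̂|; the layer-cake estimate `Lq_sdiff_le_of_indicator_bound` reduces the
remainder to indicator functions by Minkowski's inequality in ℓ_{2/p}.

It remains to find the growth of W_m. Put v = (ω/η)^{1/(s-1)}, which is `quotientWeight α` with α =
s/(2(s-1)). If all coordinates but one are fixed at b, then v ∼ G(b)|x| in the remaining coordinate
x, where G(b) = ∏(1+b_j^2)^α. This line therefore carries about 2T/G(b) points with v ≤ T. The sum
over b factorizes into 2T(2S+1)^{d-1}, and there are d axes, so #{v ≤ T} ∼ KT with K =
2d(2S+1)^{d-1} (`tendsto_ncard_quotientWeight_div`).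

Hence the j-th smallest value of v is ∼ j/K, and W_m ∼ c m^a with a = (s-1)p+1 and c =
K^{-(s-1)p}/a. Maximizing (m-n)^b/(c m^a) with b = p/2, where the optimum is m ≈ na/(a-b), gives the
limit (`tendsto_of_sup_characterization`). -/

/-- If outside every finite set there is an element that is `R`-related to everything outside that
set, these elements can be listed one after the other. -/
lemma exists_greedy_seq {ι : Type*} [DecidableEq ι] {R : ι → ι → Prop}
    (h : ∀ F : Finset ι, ∃ k ∉ F, ∀ l ∉ F, R k l) :
    ∃ e : ℕ → ι, Function.Injective e ∧
      ∀ i, ∀ l ∉ (Finset.range i).image e, R (e i) l := by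
  choose c hc hR using h
  let F : ℕ → Finset ι := fun n => Nat.rec ∅ (fun _ G => insert (c G) G) n
  have hF : ∀ n, F n = (Finset.range n).image fun i => c (F i) := by
    intro n
    induction n with
    | zero => rfl
    | succ n ih =>
      rw [Finset.range_add_one, Finset.image_insert, ← ih]
  refine ⟨fun i => c (F i), ?_, fun i l hl => hR _ _ (by rwa [hF i])⟩
  refine Function.Injective.of_lt_imp_ne fun i j hij heq => hc (F j) ?_
  rw [← heq, hF j]
  exact Finset.mem_image_of_mem (fun i => c (F i)) (Finset.mem_range.2 hij)

/-! ### Increasing enumerations and counting functions. -/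

section Counting

variable {ι : Type*} [DecidableEq ι] {v : ι → ℝ} {e : ℕ → ι}

lemma exists_increasing_enumeration [Infinite ι] (hv : ∀ t, {k | v k ≤ t}.Finite) :
    ∃ e : ℕ → ι, Function.Injective e ∧
      ∀ i, ∀ l ∉ (Finset.range i).image e, v (e i) ≤ v l := by
  refine exists_greedy_seq (R := fun k l => v k ≤ v l) fun F => ?_
  obtain ⟨k₀, hk₀⟩ := Infinite.exists_notMem_finset F
  have hfin : ({k | v k ≤ v k₀} \ (F : Set ι)).Finite := (hv _).subset Set.sdiff_subset
  obtain ⟨k, hk, hmin⟩ := Set.exists_min_image _ v hfin ⟨k₀, by simp, by simpa using hk₀⟩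
  refine ⟨k, by simpa using hk.2, fun l hl => ?_⟩
  by_cases hlk : v l ≤ v k₀
  · exact hmin l ⟨hlk, by simpa using hl⟩
  · exact hk.1.trans (not_le.1 hlk).le

lemma increasing_enumeration_monotone (he : Function.Injective e)
    (hmin : ∀ i, ∀ l ∉ (Finset.range i).image e, v (e i) ≤ v l) : Monotone (v ∘ e) := by
  refine monotone_nat_of_le_succ fun i => hmin i _ ?_
  simp only [Finset.mem_image, Finset.mem_range, not_exists, not_and]
  intro j hj hji
  have := he hji
  omega

/-- The first `m` elements of an increasing enumeration minimize the sums over `m` elements. -/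
lemma sum_range_increasing_enumeration_le
    (hmin : ∀ i, ∀ l ∉ (Finset.range i).image e, v (e i) ≤ v l) (m : ℕ) (M : Finset ι)
    (hM : M.card = m) : ∑ i ∈ Finset.range m, v (e i) ≤ ∑ k ∈ M, v k := by
  induction m generalizing M with
  | zero => simp_all
  | succ m ih =>
    obtain ⟨k, hk, hkl⟩ : ∃ k ∈ M, k ∉ (Finset.range m).image e := by
      by_contra! hcon
      have h1 := Finset.card_le_card (show M ⊆ (Finset.range m).image e from hcon)
      have h2 := Finset.card_image_le (s := Finset.range m) (f := e)
      simp only [Finset.card_range] at h2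
      omega
    rw [Finset.sum_range_succ, ← Finset.sum_erase_add _ _ hk]
    exact add_le_add (ih _ (by rw [Finset.card_erase_of_mem hk, hM]; rfl)) (hmin m k hkl)

/-- If `#{k | v k ≤ T} ∼ K T`, then the `j`-th smallest value of `v` is asymptotic to `j / K`. -/
lemma tendsto_increasing_enumeration_div (hv : ∀ t, {k | v k ≤ t}.Finite)
    (he : Function.Injective e)
    (hmin : ∀ i, ∀ l ∉ (Finset.range i).image e, v (e i) ≤ v l) {K : ℝ} (hK : 0 < K)
    (hcount : Tendsto (fun T : ℝ => ({k | v k ≤ T}.ncard : ℝ) / T) atTop (𝓝 K)) :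
    Tendsto (fun j : ℕ => v (e j) / j) atTop (𝓝 (1 / K)) := by
  have hmono := increasing_enumeration_monotone he hmin
  have hz : Tendsto (fun j => v (e j)) atTop atTop := by
    have h1 : Tendsto v cofinite atTop := by
      refine tendsto_atTop.2 fun b => ?_
      refine Filter.eventually_cofinite.2 ((hv b).subset fun k hk => ?_)
      exact (not_le.1 hk).le
    rw [← Nat.cofinite_eq_atTop]
    exact h1.comp he.tendsto_cofinite
  have hup : Tendsto (fun j : ℕ => ({k | v k ≤ v (e j)}.ncard : ℝ) / v (e j)) atTop (𝓝 K) :=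
    hcount.comp hz
  have hz1 : Tendsto (fun j => v (e j) - 1) atTop atTop :=
    tendsto_atTop_add_const_right _ (-1) hz
  -- Because of ties, #{v ≤ v (e j)} may exceed j. Lowering the threshold by 1 leaves only indices
  -- listed before j, and the shift does not change the limit.
  have hlow : Tendsto (fun j : ℕ => ({k | v k ≤ v (e j) - 1}.ncard : ℝ) / v (e j)) atTop (𝓝 K) := by
    have h1 := hcount.comp hz1
    have h2 : Tendsto (fun j : ℕ => 1 - (v (e j))⁻¹) atTop (𝓝 1) := by
      simpa using (tendsto_inv_atTop_zero.comp hz).const_sub 1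
    have h3 := h1.mul h2
    rw [mul_one] at h3
    refine h3.congr' ?_
    filter_upwards [hz.eventually_gt_atTop 1] with j hj
    have : v (e j) - 1 ≠ 0 := by linarith
    have : v (e j) ≠ 0 := by linarith
    simp only [Function.comp]
    field_simp
  have hmid : Tendsto (fun j : ℕ => (j : ℝ) / v (e j)) atTop (𝓝 K) := by
    refine tendsto_of_tendsto_of_tendsto_of_le_of_le' hlow hup ?_ ?_
    · filter_upwards [hz.eventually_gt_atTop 0] with j hj
      refine div_le_div_of_nonneg_right ?_ hj.le
      have : ({k | v k ≤ v (e j) - 1}.ncard) ≤ j := by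
        have hsub : {k | v k ≤ v (e j) - 1} ⊆ ((Finset.range j).image e : Finset ι) := by
          intro k hk
          by_contra hcon
          have := hmin j k (by simpa using hcon)
          have hk : v k ≤ v (e j) - 1 := hk
          linarith
        refine (Set.ncard_le_ncard hsub (Finset.finite_toSet _)).trans ?_
        rw [Set.ncard_coe_finset]
        exact Finset.card_image_le.trans (by simp)
      exact_mod_cast this
    · filter_upwards [hz.eventually_gt_atTop 0] with j hj
      refine div_le_div_of_nonneg_right ?_ hj.le
      have : j ≤ ({k | v k ≤ v (e j)}.ncard) := by
        have hsub : (((Finset.range j).image e : Finset ι) : Set ι) ⊆ {k | v k ≤ v (e j)} := by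
          intro k hk
          simp only [Finset.coe_image, Finset.coe_range, Set.mem_image, Set.mem_Iio] at hk
          obtain ⟨i, hi, rfl⟩ := hk
          exact hmono hi.le
        refine le_trans ?_ (Set.ncard_le_ncard hsub (hv _))
        rw [Set.ncard_coe_finset, Finset.card_image_of_injective _ he, Finset.card_range]
      exact_mod_cast this
  have := hmid.inv₀ hK.ne'
  simpa [inv_div, one_div] using this

end Counting

/-! ### Asymptotics of power sums. -/

/-- `∑_{j<m} j^β ∼ m^{β+1} / (β+1)`. -/
lemma tendsto_sum_range_rpow_div {β : ℝ} (hβ : 0 < β) :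
    Tendsto (fun m : ℕ => (∑ j ∈ Finset.range m, (j : ℝ) ^ β) / (m : ℝ) ^ (β + 1)) atTop
      (𝓝 (1 / (β + 1))) := by
  have hmono : ∀ m : ℕ, MonotoneOn (fun x : ℝ => x ^ β) (Set.Icc (0 : ℝ) (0 + m)) :=
    fun m x hx y hy hxy => Real.rpow_le_rpow hx.1 hxy hβ.le
  have hint : ∀ m : ℕ, ∫ x in (0 : ℝ)..(0 + m), x ^ β = (m : ℝ) ^ (β + 1) / (β + 1) := by
    intro m
    rw [integral_rpow (Or.inl (by linarith)), Real.zero_rpow (by linarith)]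
    simp
  have h1 : ∀ m : ℕ, ∑ j ∈ Finset.range m, (j : ℝ) ^ β ≤ (m : ℝ) ^ (β + 1) / (β + 1) := by
    intro m
    have := (hmono m).sum_le_integral
    rw [hint] at this
    simpa using this
  have h2 : ∀ m : ℕ, (m : ℝ) ^ (β + 1) / (β + 1) - (m : ℝ) ^ β
      ≤ ∑ j ∈ Finset.range m, (j : ℝ) ^ β := by
    intro m
    have h := (hmono m).integral_le_sum
    rw [hint] at h
    -- As 0^β = 0, the sum over 1,…,m, which dominates the integral, exceeds the sum over 0,…,m-1 by
    -- exactly m^β.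
    have h3 := Finset.sum_range_succ' (fun j : ℕ => (j : ℝ) ^ β) m
    rw [Finset.sum_range_succ] at h3
    simp only [Nat.cast_zero, Real.zero_rpow hβ.ne', add_zero] at h3
    simp only [zero_add] at h
    linarith
  have hlow : Tendsto (fun m : ℕ => 1 / (β + 1) - ((m : ℝ))⁻¹) atTop (𝓝 (1 / (β + 1))) := by
    simpa using (tendsto_inv_atTop_nhds_zero_nat (𝕜 := ℝ)).const_sub (1 / (β + 1))
  refine tendsto_of_tendsto_of_tendsto_of_le_of_le' hlow tendsto_const_nhds ?_ ?_
  · filter_upwards [eventually_gt_atTop 0] with m hm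
    have hm' : (0 : ℝ) < m := by exact_mod_cast hm
    rw [le_div_iff₀ (by positivity)]
    refine le_trans (le_of_eq ?_) (h2 m)
    rw [Real.rpow_add hm', Real.rpow_one]
    field_simp
  · filter_upwards [eventually_gt_atTop 0] with m hm
    have hm' : (0 : ℝ) < m := by exact_mod_cast hm
    rw [div_le_iff₀ (by positivity)]
    refine (h1 m).trans (le_of_eq ?_)
    ring

/-- The error y_j - L j^β is o(j^β). Since the sums of j^β diverge, the summed error is negligible
against them, which leaves the pure power case. -/
lemma tendsto_sum_range_div_rpow {β L : ℝ} (hβ : 0 < β) {y : ℕ → ℝ}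
    (hy : Tendsto (fun j : ℕ => y j / (j : ℝ) ^ β) atTop (𝓝 L)) :
    Tendsto (fun m : ℕ => (∑ j ∈ Finset.range m, y j) / (m : ℝ) ^ (β + 1)) atTop
      (𝓝 (L / (β + 1))) := by
  have hbase := tendsto_sum_range_rpow_div hβ
  have hsumtop : Tendsto (fun m : ℕ => ∑ j ∈ Finset.range m, (j : ℝ) ^ β) atTop atTop := by
    have hp : Tendsto (fun m : ℕ => (m : ℝ) ^ (β + 1)) atTop atTop :=
      (tendsto_rpow_atTop (by linarith)).comp tendsto_natCast_atTop_atTop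
    refine (hbase.pos_mul_atTop (by positivity) hp).congr' ?_
    filter_upwards [eventually_gt_atTop 0] with m hm
    have hm' : (0 : ℝ) < m := by exact_mod_cast hm
    field_simp
  have hlo : (fun j : ℕ => y j - L * (j : ℝ) ^ β) =o[atTop] fun j : ℕ => (j : ℝ) ^ β := by
    refine Asymptotics.isLittleO_of_tendsto' ?_ ?_
    · filter_upwards [eventually_gt_atTop 0] with m hm h0
      have hm' : (0 : ℝ) < m := by exact_mod_cast hm
      exact absurd h0 (by positivity)
    · have := hy.sub_const L
      rw [sub_self] at this
      refine this.congr' ?_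
      filter_upwards [eventually_gt_atTop 0] with m hm
      have hm' : (0 : ℝ) < m := by exact_mod_cast hm
      field_simp
  have hs := (hlo.sum_range (fun j => by positivity) hsumtop).tendsto_div_nhds_zero
  have h3 := (hs.mul hbase).add (hbase.const_mul L)
  rw [zero_mul, zero_add, mul_one_div] at h3
  refine h3.congr' ?_
  filter_upwards [eventually_gt_atTop 0, hsumtop.eventually_gt_atTop 0] with m hm hpos
  have hm' : (0 : ℝ) < m := by exact_mod_cast hm
  rw [Finset.sum_sub_distrib, ← Finset.mul_sum]
  field_simp
  ring

/-! ### Optimization over the number m of frequencies. -/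

/-- The weighted inequality of arithmetic and geometric means behind the optimal choice of `m`. -/
lemma rpow_sub_mul_le {a b m n : ℝ} (hb : 0 < b) (hab : b < a) (hn : 0 ≤ n) (hnm : n ≤ m) :
    (m - n) ^ b * n ^ (a - b) ≤ b ^ b * (a - b) ^ (a - b) / a ^ a * m ^ a := by
  have ha : 0 < a := hb.trans hab
  have hab' : 0 < a - b := sub_pos.2 hab
  have hm : 0 ≤ m := hn.trans hnm
  -- The weighted mean of these two points is m/a, independent of n; they coincide exactly at the
  -- optimum m = na/(a-b).
  have h := Real.geom_mean_le_arith_mean2_weighted (w₁ := b / a) (w₂ := (a - b) / a)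
    (p₁ := (m - n) / b) (p₂ := n / (a - b)) (by positivity) (by positivity)
    (div_nonneg (by linarith) hb.le) (by positivity) (by field_simp; ring)
  have h2 : b / a * ((m - n) / b) + (a - b) / a * (n / (a - b)) = m / a := by
    field_simp; ring
  rw [h2] at h
  have hmn : 0 ≤ m - n := by linarith
  have h3 := Real.rpow_le_rpow (by positivity) h ha.le
  rw [Real.mul_rpow (by positivity) (by positivity), ← Real.rpow_mul (by positivity),
    ← Real.rpow_mul (by positivity), div_mul_cancel₀ _ ha.ne', div_mul_cancel₀ _ ha.ne',
    Real.div_rpow hmn hb.le, Real.div_rpow hn hab'.le, Real.div_rpow hm ha.le,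
    div_mul_div_comm, div_le_iff₀ (by positivity)] at h3
  refine h3.trans (le_of_eq ?_)
  ring

/-- Asymptotics of `sup_{m>n} (m-n)^b / W_m` for `W_m ∼ c m^a`. -/
lemma tendsto_of_sup_characterization {a b c : ℝ} (hb : 0 < b) (hab : b < a) (hc : 0 < c)
    {W E : ℕ → ℝ} (hW : Tendsto (fun m : ℕ => W m / (m : ℝ) ^ a) atTop (𝓝 c))
    (hlow : ∀ n m : ℕ, n < m → ((m : ℝ) - n) ^ b / W m ≤ E n)
    (hup : ∀ (n : ℕ) (A : ℝ), 0 ≤ A → (∀ m : ℕ, n < m → ((m : ℝ) - n) ^ b ≤ A * W m) → E n ≤ A) :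
    Tendsto (fun n : ℕ => E n * (n : ℝ) ^ (a - b)) atTop
      (𝓝 (b ^ b * (a - b) ^ (a - b) / (c * a ^ a))) := by
  have ha : 0 < a := hb.trans hab
  have hab' : 0 < a - b := sub_pos.2 hab
  set B := b ^ b * (a - b) ^ (a - b) / a ^ a with hB
  have hBpos : 0 < B := by positivity
  have hlim : b ^ b * (a - b) ^ (a - b) / (c * a ^ a) = B / c := by
    rw [hB]; field_simp
  rw [hlim]
  refine tendsto_order.2 ⟨fun y hy => ?_, fun y hy => ?_⟩
  · -- the choice `m = ⌊n a / (a - b)⌋`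
    set x := a / (a - b) with hx
    have hx1 : 1 < x := by rw [hx, one_lt_div hab']; linarith
    let m : ℕ → ℕ := fun n => ⌊x * (n : ℝ)⌋₊
    have hm : Tendsto (fun n : ℕ => (m n : ℝ) / n) atTop (𝓝 x) :=
      (tendsto_nat_floor_mul_div_atTop (by positivity)).comp tendsto_natCast_atTop_atTop
    have hmtop : Tendsto m atTop atTop :=
      tendsto_nat_floor_atTop.comp
        (tendsto_natCast_atTop_atTop.const_mul_atTop (by positivity))
    have h1 := ((hm.sub_const 1).rpow_const (p := b) (Or.inl (by linarith))).div
      ((hW.comp hmtop).mul (hm.rpow_const (p := a) (Or.inl (by positivity)))) (by positivity)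
    have h2 : (x - 1) ^ b / (c * x ^ a) = B / c := by
      have : x - 1 = b / (a - b) := by rw [hx]; field_simp; ring
      rw [this, hx, Real.div_rpow hb.le hab'.le, Real.div_rpow ha.le hab'.le, hB,
        Real.rpow_sub hab']
      field_simp
    rw [h2] at h1
    have hgt := h1.eventually_const_lt hy
    filter_upwards [hgt, hm.eventually_const_lt hx1, eventually_gt_atTop 0] with n hn hmn hn0
    have hn' : (0 : ℝ) < n := by exact_mod_cast hn0
    have hlt : n < m n := by
      rw [one_lt_div hn'] at hmn
      exact_mod_cast hmn
    have hlt' : (n : ℝ) < m n := by exact_mod_cast hlt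
    have hm' : (0 : ℝ) < m n := hn'.trans hlt'
    refine hn.trans_le ?_
    refine le_trans (le_of_eq ?_) (mul_le_mul_of_nonneg_right (hlow n (m n) hlt) (by positivity))
    simp only [Function.comp, Pi.div_apply]
    have : (m n : ℝ) / n - 1 = ((m n : ℝ) - n) / n := by field_simp
    rw [this, Real.div_rpow (by linarith) hn'.le, Real.div_rpow hm'.le hn'.le,
      Real.rpow_sub hn']
    -- Nothing is assumed about zeros of W; at a zero both sides are 0 because x/0 = 0.
    by_cases hWm : W (m n) = 0
    · simp [hWm]
    · field_simp
  · obtain ⟨c', hc'0, hc', hyc⟩ : ∃ c', 0 < c' ∧ c' < c ∧ B / c' < y := by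
      have hcont : Tendsto (fun t : ℝ => B / t) (𝓝[<] c) (𝓝 (B / c)) :=
        ((tendsto_const_nhds.div tendsto_id hc.ne').mono_left nhdsWithin_le_nhds)
      have h1 := hcont.eventually_lt_const hy
      have h2 : ∀ᶠ t in 𝓝[<] c, t < c := eventually_mem_nhdsWithin
      have h3 : ∀ᶠ t in 𝓝[<] c, 0 < t :=
        (eventually_gt_nhds hc).filter_mono nhdsWithin_le_nhds
      obtain ⟨t, h⟩ := (h1.and (h2.and h3)).exists
      exact ⟨t, h.2.2, h.2.1, h.1⟩
    -- Only m > n compete in the supremum, so for n ≥ N the asymptotic lower bound c' m^a on W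
    -- applies to all of them at once.
    obtain ⟨N, hN⟩ := eventually_atTop.1 (hW.eventually_const_lt hc')
    filter_upwards [eventually_ge_atTop N, eventually_gt_atTop 0] with n hn hn0
    have hn' : (0 : ℝ) < n := by exact_mod_cast hn0
    refine lt_of_le_of_lt ?_ hyc
    have hE := hup n (B / c' / (n : ℝ) ^ (a - b)) (by positivity) fun m hm => ?_
    · rwa [le_div_iff₀ (by positivity)] at hE
    · have hm' : (n : ℝ) < m := by exact_mod_cast hm
      have hm0 : (0 : ℝ) < m := hn'.trans hm'
      have h1 := hN m (hn.trans hm.le)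
      rw [lt_div_iff₀ (by positivity)] at h1
      have h2 := rpow_sub_mul_le hb hab hn'.le hm'.le
      rw [← hB] at h2
      rw [div_div, div_mul_eq_mul_div, le_div_iff₀ (by positivity)]
      calc ((m : ℝ) - n) ^ b * (c' * (n : ℝ) ^ (a - b))
          = c' * (((m : ℝ) - n) ^ b * (n : ℝ) ^ (a - b)) := by ring
        _ ≤ c' * (B * (m : ℝ) ^ a) := by gcongr
        _ = B * (c' * (m : ℝ) ^ a) := by ring
        _ ≤ B * W m := by gcongr

/-! ### Fourier coefficients on the torus. -/

section Coefficients

variable {d : ℕ}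

lemma integrable_mul_trig (f : TorusL1 d) (k : Fin d → ℤ) :
    Integrable (fun x => f x * trig (-k) x) (torusMeasure d) := by
  refine (L1.integrable_coeFn f).mul_bdd (c := ‖(trig (-k) : C(Torus d, ℂ))‖)
    (trig (-k)).continuous.aestronglyMeasurable ?_
  exact Filter.Eventually.of_forall fun x => ContinuousMap.norm_coe_le_norm _ x

lemma torusCoeff_add (f g : TorusL1 d) (k : Fin d → ℤ) :
    torusCoeff (f + g) k = torusCoeff f k + torusCoeff g k := by
  unfold torusCoeff
  rw [← integral_add (integrable_mul_trig f k) (integrable_mul_trig g k)]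
  refine integral_congr_ae ?_
  filter_upwards [Lp.coeFn_add f g] with x hx
  rw [hx, Pi.add_apply, add_mul]

lemma torusCoeff_smul (a : ℂ) (f : TorusL1 d) (k : Fin d → ℤ) :
    torusCoeff (a • f) k = a * torusCoeff f k := by
  unfold torusCoeff
  rw [← integral_const_mul]
  refine integral_congr_ae ?_
  filter_upwards [Lp.coeFn_smul a f] with x hx
  rw [hx, Pi.smul_apply, smul_eq_mul, mul_assoc]

/-- The `k`-th Fourier coefficient as a linear functional. -/
noncomputable def torusCoeffₗ (k : Fin d → ℤ) : TorusL1 d →ₗ[ℂ] ℂ where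
  toFun f := torusCoeff f k
  map_add' f g := torusCoeff_add f g k
  map_smul' a f := torusCoeff_smul a f k

/-- For m ≠ 0, translation by half a period of e^{imx} changes its sign but preserves Haar measure.
-/
lemma integral_fourier_eq_ite (m : ℤ) :
    ∫ x : AddCircle (2 * π), fourier m x ∂AddCircle.haarAddCircle = if m = 0 then 1 else 0 := by
  split_ifs with h
  · simp [h]
  · exact integral_eq_zero_of_add_right_eq_neg
      (fourier_add_half_inv_index h factTwoPiPos.elim)

/-- The element `e^{ikx}` of `L_1(𝕋^d)`. -/
noncomputable def trigL1 (k : Fin d → ℤ) : TorusL1 d :=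
  ContinuousMap.toLp (E := ℂ) 1 (torusMeasure d) ℂ (trig k)

lemma torusCoeff_trigL1 (k l : Fin d → ℤ) :
    torusCoeff (trigL1 k) l = if k = l then 1 else 0 := by
  have h1 : torusCoeff (trigL1 k) l
      = ∫ x, ∏ j, fourier (k j - l j) (x j) ∂(torusMeasure d) := by
    unfold torusCoeff trigL1
    refine integral_congr_ae ?_
    filter_upwards [ContinuousMap.coeFn_toLp (p := 1) (𝕜 := ℂ) (torusMeasure d) (trig k)]
      with x hx
    rw [hx]
    simp only [trig, ContinuousMap.coe_mk, ← Finset.prod_mul_distrib, Pi.neg_apply]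
    refine Finset.prod_congr rfl fun j _ => ?_
    rw [sub_eq_add_neg, fourier_add]
  rw [h1, integral_fintype_prod_eq_prod (fun j x => fourier (k j - l j) x)]
  simp only [integral_fourier_eq_ite, sub_eq_zero]
  rw [Finset.prod_ite_zero]
  simp [funext_iff]

lemma torusCoeff_sum_smul_trigL1 {σ : Type*} (A : Finset σ) (a : σ → ℂ) (κ : σ → Fin d → ℤ)
    (l : Fin d → ℤ) :
    torusCoeff (∑ j ∈ A, a j • trigL1 (κ j)) l = ∑ j ∈ A, if κ j = l then a j else 0 := by
  change torusCoeffₗ l _ = _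
  rw [map_sum]
  refine Finset.sum_congr rfl fun j _ => ?_
  rw [map_smul]
  change a j • torusCoeff (trigL1 (κ j)) l = _
  rw [torusCoeff_trigL1]
  simp

lemma torusCoeff_sub_sum (f : TorusL1 d) {σ : Type*} (A : Finset σ) (a : σ → ℂ)
    (κ : σ → Fin d → ℤ) (l : Fin d → ℤ) :
    torusCoeff (f - ∑ j ∈ A, a j • trigL1 (κ j)) l
      = torusCoeff f l - ∑ j ∈ A, if κ j = l then a j else 0 := by
  rw [← torusCoeff_sum_smul_trigL1]
  exact map_sub (torusCoeffₗ l) _ _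

end Coefficients

/-! ### Reduction to indicator functions, and largest terms. -/

section LayerCake

variable {ι : Type*} [DecidableEq ι]

/-- Layer-cake estimate: if `Γ` carries the largest values of `y` on `F`, the `ℓ_q` norm of `y` on
`F \ Γ` is at most the weighted `ℓ_1` norm times the constant obtained from indicator functions. -/
lemma Lq_sdiff_le_of_indicator_bound {q A : ℝ} (hq : 1 ≤ q) {v : ι → ℝ} (hv : ∀ k, 0 ≤ v k)
    (hA : 0 ≤ A) {F Γ : Finset ι} (hΓF : Γ ⊆ F)
    (hbound : ∀ M : Finset ι, Γ.card < M.card →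
      ((M.card : ℝ) - Γ.card) ^ (1 / q) ≤ A * ∑ k ∈ M, v k)
    (y : ι → ℝ) (hy : ∀ k, 0 ≤ y k) (hdom : ∀ k ∈ Γ, ∀ l ∈ F \ Γ, y l ≤ y k) :
    (∑ k ∈ F \ Γ, y k ^ q) ^ (1 / q) ≤ A * ∑ k ∈ F, v k * y k := by
  have hq0 : 0 < q := by linarith
  induction hn : (F.filter fun k => 0 < y k).card using Nat.strong_induction_on generalizing y with
  | _ n ih =>
  set M := F.filter fun k => 0 < y k with hM
  -- If y vanishes on F \ Γ, the left side is 0. Otherwise Γ lies in the support M of y in F. With c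
  -- the least positive value there, y = y' + c·1_M on F: y' has smaller support and keeps the
  -- order, and Minkowski adds its bound to the one for 1_M.
  by_cases hcase : ∃ l ∈ F \ Γ, 0 < y l
  · obtain ⟨l₀, hl₀, hpos⟩ := hcase
    have hl₀' := Finset.mem_sdiff.1 hl₀
    have hl₀M : l₀ ∈ M := Finset.mem_filter.2 ⟨hl₀'.1, hpos⟩
    have hΓM : Γ ⊆ M := fun k hk =>
      Finset.mem_filter.2 ⟨hΓF hk, hpos.trans_le (hdom k hk l₀ hl₀)⟩
    have hcard : Γ.card < M.card :=
      Finset.card_lt_card ⟨hΓM, fun h => hl₀'.2 (h hl₀M)⟩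
    obtain ⟨k₁, hk₁, hmin⟩ := Finset.exists_min_image M y ⟨l₀, hl₀M⟩
    set c := y k₁ with hc
    have hc0 : 0 < c := (Finset.mem_filter.1 hk₁).2
    let y' : ι → ℝ := fun k => if k ∈ M then y k - c else 0
    have hy' : ∀ k, 0 ≤ y' k := by
      intro k
      by_cases hk : k ∈ M
      · simpa [y', hk] using hmin k hk
      · simp [y', hk]
    have hyF : ∀ k ∈ F, y k = y' k + if k ∈ M then c else 0 := by
      intro k hk
      by_cases hkM : k ∈ M
      · simp [y', hkM]
      · have : ¬ 0 < y k := fun h => hkM (Finset.mem_filter.2 ⟨hk, h⟩)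
        simp only [y', hkM, if_false, add_zero]
        exact le_antisymm (not_lt.1 this) (hy k)
    have hdom' : ∀ k ∈ Γ, ∀ l ∈ F \ Γ, y' l ≤ y' k := by
      intro k hk l hl
      by_cases hlM : l ∈ M
      · simpa [y', hlM, hΓM hk] using hdom k hk l hl
      · simp only [y', hlM, if_false]
        exact hy' k
    have hlt : (F.filter fun k => 0 < y' k).card < n := by
      rw [← hn]
      refine Finset.card_lt_card ⟨fun k hk => ?_, fun h => ?_⟩
      · by_contra hkM
        simp [y', hkM] at hk
      · have := (Finset.mem_filter.1 (h hk₁)).2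
        simp [y', hk₁, ← hc] at this
    have hrec := ih _ hlt y' hy' hdom' rfl
    have hmink := Real.Lp_add_le_of_nonneg (F \ Γ) hq (f := y') (g := fun k => if k ∈ M then c else 0)
      (fun k _ => hy' k) (fun k _ => by split_ifs <;> positivity)
    have hsplit : ∑ k ∈ F, v k * y k = ∑ k ∈ F, v k * y' k + c * ∑ k ∈ M, v k := by
      have h1 : ∑ k ∈ M, v k = ∑ k ∈ F, if k ∈ M then v k else 0 := by
        rw [← Finset.sum_filter, Finset.filter_mem_eq_inter,
          Finset.inter_eq_right.2 (Finset.filter_subset _ _)]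
      rw [h1, Finset.mul_sum, ← Finset.sum_add_distrib]
      refine Finset.sum_congr rfl fun k hk => ?_
      rw [hyF k hk]
      split_ifs <;> ring
    have hind : (∑ k ∈ F \ Γ, (if k ∈ M then c else 0) ^ q) ^ (1 / q)
        = c * ((M.card : ℝ) - Γ.card) ^ (1 / q) := by
      have h1 : ∑ k ∈ F \ Γ, (if k ∈ M then c else 0) ^ q = ((M.card : ℝ) - Γ.card) * c ^ q := by
        have h2 : ∀ k, (if k ∈ M then c else 0) ^ q = if k ∈ M then c ^ q else 0 := by
          intro k
          split_ifs
          · rfl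
          · exact Real.zero_rpow hq0.ne'
        have h3 : (F \ Γ) ∩ M = M \ Γ := by
          ext k
          simp only [Finset.mem_inter, Finset.mem_sdiff]
          exact ⟨fun h => ⟨h.2, h.1.2⟩, fun h => ⟨⟨Finset.filter_subset _ _ h.1, h.2⟩, h.1⟩⟩
        simp only [h2]
        rw [← Finset.sum_filter, Finset.filter_mem_eq_inter, h3, Finset.sum_const,
          Finset.card_sdiff_of_subset hΓM, nsmul_eq_mul, Nat.cast_sub hcard.le]
      have h4 : (0 : ℝ) ≤ (M.card : ℝ) - Γ.card := by
        rw [sub_nonneg]; exact_mod_cast hcard.le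
      rw [h1, Real.mul_rpow h4 (by positivity), ← Real.rpow_mul hc0.le,
        mul_one_div_cancel hq0.ne', Real.rpow_one, mul_comm]
    calc (∑ k ∈ F \ Γ, y k ^ q) ^ (1 / q)
        = (∑ k ∈ F \ Γ, (y' k + if k ∈ M then c else 0) ^ q) ^ (1 / q) := by
          congr 1
          refine Finset.sum_congr rfl fun k hk => ?_
          rw [hyF k (Finset.mem_sdiff.1 hk).1]
      _ ≤ _ := hmink
      _ ≤ A * ∑ k ∈ F, v k * y' k + c * (A * ∑ k ∈ M, v k) := by
          rw [hind]
          gcongr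
          exact hbound M hcard
      _ = A * ∑ k ∈ F, v k * y k := by rw [hsplit]; ring
  · push Not at hcase
    have h0 : ∑ k ∈ F \ Γ, y k ^ q = 0 := by
      refine Finset.sum_eq_zero fun k hk => ?_
      rw [le_antisymm (hcase k hk) (hy k), Real.zero_rpow hq0.ne']
    rw [h0, Real.zero_rpow (by positivity)]
    exact mul_nonneg hA (Finset.sum_nonneg fun k _ => mul_nonneg (hv k) (hy k))

/-- A nonnegative family tending to zero has `n` largest terms. -/
lemma exists_finset_largest [Infinite ι] {x : ι → ℝ} (hx0 : ∀ k, 0 ≤ x k)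
    (hx : ∀ ε > 0, {k | ε ≤ x k}.Finite) (n : ℕ) :
    ∃ Γ : Finset ι, Γ.card = n ∧ ∀ k ∈ Γ, ∀ l ∉ Γ, x l ≤ x k := by
  obtain ⟨e, he, hmax⟩ := exists_greedy_seq (R := fun k l => x l ≤ x k) fun F => by
    by_cases h : ∃ k ∉ F, 0 < x k
    · obtain ⟨k₀, hk₀, hpos⟩ := h
      have hfin : ({k | x k₀ ≤ x k} \ (F : Set ι)).Finite := (hx _ hpos).subset Set.sdiff_subset
      obtain ⟨k, hk, hmax⟩ := Set.exists_max_image _ x hfin ⟨k₀, by simp, by simpa using hk₀⟩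
      refine ⟨k, by simpa using hk.2, fun l hl => ?_⟩
      by_cases hlk : x k₀ ≤ x l
      · exact hmax l ⟨hlk, by simpa using hl⟩
      · exact (not_le.1 hlk).le.trans hk.1
    -- Finiteness is known only for levels ε > 0; but here all values outside F are 0, so any index
    -- outside F will do.
    · push Not at h
      obtain ⟨k, hk⟩ := Infinite.exists_notMem_finset F
      exact ⟨k, hk, fun l hl => (h l hl).trans (hx0 k)⟩
  refine ⟨(Finset.range n).image e, by rw [Finset.card_image_of_injective _ he, Finset.card_range],
    fun k hk l hl => ?_⟩
  obtain ⟨i, hi, rfl⟩ := Finset.mem_image.1 hk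
  refine hmax i l fun h => hl (Finset.image_subset_image ?_ h)
  exact Finset.range_subset_range.2 (Finset.mem_range.1 hi).le

end LayerCake

/-! ### Matching bounds for the n-term width. -/

section WidthBounds

variable {d : ℕ} {ω η : (Fin d → ℤ) → ℝ} {p : ℝ}

/-- Trigonometric polynomials with equal weighted coefficients on `M` bound the width from below. -/
lemma le_nTermWidth (hω : ∀ k, 0 < ω k) (hη : ∀ k, 0 < η k) (hp : 0 < p) {n : ℕ}
    {M : Finset (Fin d → ℤ)} (hM : n < M.card) :
    ENNReal.ofReal ((((M.card : ℝ) - n) ^ (p / 2) / ∑ k ∈ M, (ω k / η k) ^ p) ^ (1 / p)) ≤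
      nTermWidth (weightedNorm ω p) (weightedNorm η 2) (trigSystem d) n := by
  classical
  set W := ∑ k ∈ M, (ω k / η k) ^ p with hWdef
  have hMne : M.Nonempty := Finset.card_pos.1 (by omega)
  have hW : 0 < W := Finset.sum_pos (fun k _ => Real.rpow_pos_of_pos (div_pos (hω k) (hη k)) _) hMne
  -- The common value of η|f̂| on M, normalized so that f has norm 1 in the source space.
  set c : ℝ := (W⁻¹) ^ (1 / p) with hc
  have hc0 : 0 < c := by positivity
  have hcp : c ^ p = W⁻¹ := by
    rw [hc, ← Real.rpow_mul (by positivity), one_div_mul_cancel hp.ne', Real.rpow_one]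
  have hmn : (0 : ℝ) < (M.card : ℝ) - n := by
    rw [sub_pos]; exact_mod_cast hM
  let f : TorusL1 d := ∑ k ∈ M, ((c / η k : ℝ) : ℂ) • trigL1 k
  have hf : ∀ l, torusCoeff f l = if l ∈ M then ((c / η l : ℝ) : ℂ) else 0 := by
    intro l
    have := torusCoeff_sum_smul_trigL1 M (fun k => ((c / η k : ℝ) : ℂ)) id l
    simp only [id] at this
    rw [Finset.sum_ite_eq' M l (fun k => ((c / η k : ℝ) : ℂ))] at this
    exact this
  have hfnorm : ∀ l ∈ M, ‖torusCoeff f l‖ = c / η l := by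
    intro l hl
    rw [hf, if_pos hl, Complex.norm_real, Real.norm_of_nonneg (div_pos hc0 (hη l)).le]
  have hNX : weightedNorm ω p f ≤ 1 := by
    unfold weightedNorm
    have h1 : ∑' k, ENNReal.ofReal ((ω k * ‖torusCoeff f k‖) ^ p) = 1 := by
      rw [tsum_eq_sum (s := M)]
      · rw [← ENNReal.ofReal_sum_of_nonneg fun k _ => by
          have := (hω k).le
          positivity]
        rw [← ENNReal.ofReal_one]
        congr 1
        calc ∑ k ∈ M, (ω k * ‖torusCoeff f k‖) ^ p = ∑ k ∈ M, (ω k / η k) ^ p * c ^ p := by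
              refine Finset.sum_congr rfl fun k hk => ?_
              rw [hfnorm k hk, ← Real.mul_rpow (div_pos (hω k) (hη k)).le hc0.le]
              congr 1
              ring
          _ = 1 := by rw [← Finset.sum_mul, ← hWdef, hcp, mul_inv_cancel₀ hW.ne']
      · intro k hk
        rw [hf, if_neg hk, norm_zero, mul_zero, Real.zero_rpow hp.ne', ENNReal.ofReal_zero]
    rw [h1, ENNReal.one_rpow]
  refine le_trans ?_ (le_iSup₂ (f := fun (f : TorusL1 d) (_ : weightedNorm ω p f ≤ 1) =>
    nTermError (weightedNorm η 2) (trigSystem d) n f) f hNX)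
  refine le_iInf₂ fun a y => ?_
  choose κ hκ using fun j => (y j).2
  have hy : ∑ j, a j • (y j : TorusL1 d) = ∑ j, a j • trigL1 (κ j) :=
    Finset.sum_congr rfl fun j _ => by rw [← hκ j]; rfl
  rw [hy]
  -- On the frequencies of M unused by the approximant the error keeps the coefficient of f, so each
  -- contributes c² to the squared norm.
  set Q := M \ Finset.univ.image κ with hQ
  have hQcard : (M.card : ℝ) - n ≤ Q.card := by
    have h1 := Finset.le_card_sdiff (Finset.univ.image κ) M
    rw [← hQ] at h1
    have h2 := Finset.card_image_le (s := (Finset.univ : Finset (Fin n))) (f := κ)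
    rw [Finset.card_univ, Fintype.card_fin] at h2
    have h3 : M.card ≤ Q.card + n := by omega
    rw [sub_le_iff_le_add]
    exact_mod_cast h3
  have hterm : ∀ l ∈ Q, ENNReal.ofReal
      ((η l * ‖torusCoeff (f - ∑ j, a j • trigL1 (κ j)) l‖) ^ (2 : ℝ)) = ENNReal.ofReal (c ^ 2) := by
    intro l hl
    obtain ⟨hlM, hlκ⟩ := Finset.mem_sdiff.1 hl
    rw [torusCoeff_sub_sum, Finset.sum_eq_zero, sub_zero, hfnorm l hlM, mul_div_cancel₀ _ (hη l).ne',
      Real.rpow_two]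
    intro j _
    rw [if_neg]
    rintro rfl
    exact hlκ (Finset.mem_image_of_mem _ (Finset.mem_univ j))
  have hlow : ENNReal.ofReal (((M.card : ℝ) - n) * c ^ 2) ≤ ∑' l, ENNReal.ofReal
      ((η l * ‖torusCoeff (f - ∑ j, a j • trigL1 (κ j)) l‖) ^ (2 : ℝ)) := by
    refine le_trans ?_ (ENNReal.sum_le_tsum Q)
    rw [Finset.sum_congr rfl hterm, ← ENNReal.ofReal_sum_of_nonneg fun _ _ => by positivity]
    refine ENNReal.ofReal_le_ofReal ?_
    rw [Finset.sum_const, nsmul_eq_mul]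
    gcongr
  unfold weightedNorm
  refine le_trans (le_of_eq ?_) (ENNReal.rpow_le_rpow hlow (by norm_num))
  rw [ENNReal.ofReal_rpow_of_pos (by positivity)]
  congr 1
  rw [div_eq_mul_inv, Real.mul_rpow (by positivity) (by positivity), ← hc,
    ← Real.rpow_mul hmn.le, Real.mul_rpow hmn.le (by positivity), ← Real.sqrt_eq_rpow (c ^ 2),
    Real.sqrt_sq hc0.le]
  congr 2
  field_simp

/-- The upper bound of the width by the constant in the inequality for indicator functions. -/
lemma nTermWidth_le [NeZero d] (hη : ∀ k, 0 < η k) (hηω : ∀ k, η k ≤ ω k) (hp : 0 < p)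
    (hp2 : p ≤ 2) {n : ℕ} {A : ℝ} (hA : 0 ≤ A)
    (hbound : ∀ M : Finset (Fin d → ℤ), n < M.card →
      ((M.card : ℝ) - n) ^ (p / 2) ≤ A * ∑ k ∈ M, (ω k / η k) ^ p) :
    nTermWidth (weightedNorm ω p) (weightedNorm η 2) (trigSystem d) n ≤
      ENNReal.ofReal (A ^ (1 / p)) := by
  classical
  have hω : ∀ k, 0 < ω k := fun k => (hη k).trans_le (hηω k)
  refine iSup₂_le fun f hf => ?_
  have hsum : ∑' k, ENNReal.ofReal ((ω k * ‖torusCoeff f k‖) ^ p) ≤ 1 := by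
    have h1 := ENNReal.rpow_le_rpow hf hp.le
    unfold weightedNorm at h1
    rwa [← ENNReal.rpow_mul, one_div_mul_cancel hp.ne', ENNReal.rpow_one, ENNReal.one_rpow] at h1
  set x : (Fin d → ℤ) → ℝ := fun k => η k * ‖torusCoeff f k‖ with hx
  have hx0 : ∀ k, 0 ≤ x k := fun k => mul_nonneg (hη k).le (norm_nonneg _)
  have hxω : ∀ k, x k ≤ ω k * ‖torusCoeff f k‖ :=
    fun k => mul_le_mul_of_nonneg_right (hηω k) (norm_nonneg _)
  have hfin : ∀ ε > 0, {k | ε ≤ x k}.Finite := by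
    intro ε hε
    have hne : ∑' k, ENNReal.ofReal ((ω k * ‖torusCoeff f k‖) ^ p) ≠ ∞ :=
      ne_top_of_le_ne_top ENNReal.one_ne_top hsum
    have hε0 : ENNReal.ofReal (ε ^ p) ≠ 0 := by
      have : 0 < ε ^ p := by positivity
      simpa using this
    refine (ENNReal.finite_const_le_of_tsum_ne_top hne hε0).subset fun k hk => ?_
    refine ENNReal.ofReal_le_ofReal (Real.rpow_le_rpow hε.le ?_ hp.le)
    exact le_trans hk (hxω k)
  obtain ⟨Γ, hΓ, hdom⟩ := exists_finset_largest hx0 hfin n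
  let κ : Fin n → (Fin d → ℤ) := fun j => (Γ.equivFinOfCardEq hΓ).symm j
  refine (iInf₂_le (fun j => torusCoeff f (κ j)) (fun j => ⟨trigL1 (κ j), κ j, rfl⟩)).trans ?_
  have hcoeff : ∀ l, torusCoeff (f - ∑ j, torusCoeff f (κ j) • trigL1 (κ j)) l
      = if l ∈ Γ then 0 else torusCoeff f l := by
    intro l
    rw [torusCoeff_sub_sum]
    have h1 : ∑ j, (if κ j = l then torusCoeff f (κ j) else 0)
        = ∑ k ∈ Γ, if k = l then torusCoeff f k else 0 := by
      rw [← Finset.sum_coe_sort Γ]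
      exact Equiv.sum_comp (Γ.equivFinOfCardEq hΓ).symm
        fun k : Γ => if (k : Fin d → ℤ) = l then torusCoeff f k else 0
    rw [h1, Finset.sum_ite_eq']
    split_ifs <;> simp
  have hAq : (A ^ (2 / p)) ^ (1 / 2 : ℝ) = A ^ (1 / p) := by
    rw [← Real.rpow_mul hA]
    congr 1
    field_simp
  unfold weightedNorm
  rw [← hAq, ← ENNReal.ofReal_rpow_of_nonneg (by positivity) (by norm_num)]
  refine ENNReal.rpow_le_rpow ?_ (by norm_num)
  rw [ENNReal.tsum_eq_iSup_sum]
  refine iSup_le fun F => ?_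
  set G := F ∪ Γ with hG
  -- Applied to x^p in ℓ_q with q = 2/p; the assumption p ≤ 2 gives the q ≥ 1 that Minkowski needs.
  have hlayer := Lq_sdiff_le_of_indicator_bound (q := 2 / p) (A := A)
    (by rw [le_div_iff₀ hp]; linarith) (v := fun k => (ω k / η k) ^ p)
    (fun k => by have := div_pos (hω k) (hη k); positivity) hA
    (F := G) (Γ := Γ) Finset.subset_union_right
    (by rw [hΓ, one_div_div]; exact hbound)
    (fun k => x k ^ p) (fun k => Real.rpow_nonneg (hx0 k) _)
    (fun k hk l hl => Real.rpow_le_rpow (hx0 l) (hdom k hk l (Finset.mem_sdiff.1 hl).2) hp.le)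
  have hle1 : ∑ k ∈ G, (ω k / η k) ^ p * x k ^ p ≤ 1 := by
    have h1 : ∑ k ∈ G, (ω k / η k) ^ p * x k ^ p = ∑ k ∈ G, (ω k * ‖torusCoeff f k‖) ^ p := by
      refine Finset.sum_congr rfl fun k _ => ?_
      rw [← Real.mul_rpow (div_pos (hω k) (hη k)).le (hx0 k), hx]
      congr 1
      have := (hη k).ne'
      field_simp
    rw [h1, ← ENNReal.ofReal_le_ofReal_iff zero_le_one, ENNReal.ofReal_one,
      ENNReal.ofReal_sum_of_nonneg fun k _ => by
        have := (hω k).le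
        positivity]
    exact (ENNReal.sum_le_tsum G).trans hsum
  have hxq : ∀ k, (x k ^ p) ^ (2 / p) = x k ^ (2 : ℝ) := by
    intro k
    rw [← Real.rpow_mul (hx0 k), mul_div_cancel₀ _ hp.ne']
  simp only [hxq, one_div_div] at hlayer
  have hsq0 : 0 ≤ ∑ k ∈ G \ Γ, x k ^ (2 : ℝ) :=
    Finset.sum_nonneg fun k _ => Real.rpow_nonneg (hx0 k) _
  have hle2 : ∑ k ∈ G \ Γ, x k ^ (2 : ℝ) ≤ A ^ (2 / p) := by
    have h2 := Real.rpow_le_rpow (by positivity)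
      (hlayer.trans (mul_le_of_le_one_right hA hle1)) (z := 2 / p) (by positivity)
    rwa [← Real.rpow_mul hsq0, show p / 2 * (2 / p) = 1 by field_simp, Real.rpow_one] at h2
  calc ∑ l ∈ F, ENNReal.ofReal
        ((η l * ‖torusCoeff (f - ∑ j, torusCoeff f (κ j) • trigL1 (κ j)) l‖) ^ (2 : ℝ))
      ≤ ∑ l ∈ G, ENNReal.ofReal
        ((η l * ‖torusCoeff (f - ∑ j, torusCoeff f (κ j) • trigL1 (κ j)) l‖) ^ (2 : ℝ)) :=
        Finset.sum_le_sum_of_subset Finset.subset_union_left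
    _ = ∑ l ∈ G \ Γ, ENNReal.ofReal (x l ^ (2 : ℝ)) := by
        rw [← Finset.sum_sdiff (Finset.subset_union_right : Γ ⊆ G)]
        rw [Finset.sum_eq_zero (s := Γ), add_zero]
        · refine Finset.sum_congr rfl fun l hl => ?_
          rw [hcoeff, if_neg (Finset.mem_sdiff.1 hl).2]
        · intro l hl
          rw [hcoeff, if_pos hl, norm_zero, mul_zero, Real.zero_rpow (by norm_num),
            ENNReal.ofReal_zero]
    _ = ENNReal.ofReal (∑ l ∈ G \ Γ, x l ^ (2 : ℝ)) :=
        (ENNReal.ofReal_sum_of_nonneg fun k _ => Real.rpow_nonneg (hx0 k) _).symm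
    _ ≤ ENNReal.ofReal (A ^ (2 / p)) := ENNReal.ofReal_le_ofReal hle2

/-- The constant A = 1 suffices: |M| - n ≥ 1 and p/2 ≤ 1 give (|M|-n)^{p/2} ≤ |M|, and each (ω/η)^p
is at least 1. Finiteness makes passing to `toReal` harmless. -/
lemma nTermWidth_ne_top [NeZero d] (hη : ∀ k, 0 < η k) (hηω : ∀ k, η k ≤ ω k) (hp : 0 < p)
    (hp2 : p ≤ 2) (n : ℕ) :
    nTermWidth (weightedNorm ω p) (weightedNorm η 2) (trigSystem d) n ≠ ∞ := by
  refine ne_top_of_le_ne_top ENNReal.ofReal_ne_top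
    (nTermWidth_le (A := 1) hη hηω hp hp2 zero_le_one fun M hM => ?_)
  have hn : (n : ℝ) + 1 ≤ M.card := by exact_mod_cast hM
  have hn0 : (0 : ℝ) ≤ n := n.cast_nonneg
  calc ((M.card : ℝ) - n) ^ (p / 2) ≤ ((M.card : ℝ) - n) ^ (1 : ℝ) :=
        Real.rpow_le_rpow_of_exponent_le (by linarith) (by linarith)
    _ ≤ ∑ k ∈ M, (1 : ℝ) := by simp
    _ ≤ 1 * ∑ k ∈ M, (ω k / η k) ^ p := by
        rw [one_mul]
        refine Finset.sum_le_sum fun k _ => Real.one_le_rpow ?_ hp.le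
        rw [one_le_div (hη k)]
        exact hηω k

/-- The widths are determined asymptotically by the counting function of the quotient of the
weights. -/
lemma tendsto_nTermWidth [NeZero d] (hη : ∀ k, 0 < η k) (hηω : ∀ k, η k ≤ ω k) (hp : 0 < p)
    (hp2 : p ≤ 2) {r K : ℝ} (hr : 0 < r) (hK : 0 < K) {v : (Fin d → ℤ) → ℝ} (hv0 : ∀ k, 0 ≤ v k)
    (hvr : ∀ k, v k ^ r = ω k / η k) (hv : ∀ t, {k | v k ≤ t}.Finite)
    (hcount : Tendsto (fun T : ℝ => ({k | v k ≤ T}.ncard : ℝ) / T) atTop (𝓝 K)) :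
    Tendsto (fun n : ℕ =>
      (nTermWidth (weightedNorm ω p) (weightedNorm η 2) (trigSystem d) n).toReal *
        (n : ℝ) ^ ((r * p + 1 - p / 2) / p)) atTop
      (𝓝 (((p / 2) ^ (p / 2) * (r * p + 1 - p / 2) ^ (r * p + 1 - p / 2) /
        ((1 / K) ^ (r * p) / (r * p + 1) * (r * p + 1) ^ (r * p + 1))) ^ (1 / p))) := by
  have hω : ∀ k, 0 < ω k := fun k => (hη k).trans_le (hηω k)
  obtain ⟨e, he, hmin⟩ := exists_increasing_enumeration hv
  have hvp : ∀ k, (ω k / η k) ^ p = v k ^ (r * p) := by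
    intro k
    rw [← hvr, ← Real.rpow_mul (hv0 k)]
  have hmin' : ∀ i, ∀ l ∉ (Finset.range i).image e,
      (ω (e i) / η (e i)) ^ p ≤ (ω l / η l) ^ p := by
    intro i l hl
    rw [hvp, hvp]
    exact Real.rpow_le_rpow (hv0 _) (hmin i l hl) (by positivity)
  let W : ℕ → ℝ := fun m => ∑ i ∈ Finset.range m, (ω (e i) / η (e i)) ^ p
  have hW : Tendsto (fun m : ℕ => W m / (m : ℝ) ^ (r * p + 1)) atTop
      (𝓝 ((1 / K) ^ (r * p) / (r * p + 1))) := by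
    refine tendsto_sum_range_div_rpow (by positivity) ?_
    have h1 := (tendsto_increasing_enumeration_div hv he hmin hK hcount).rpow_const
      (p := r * p) (Or.inl (by positivity))
    refine h1.congr fun j => ?_
    rw [Real.div_rpow (hv0 _) (by positivity), hvp]
  have hmain := tendsto_of_sup_characterization (a := r * p + 1) (b := p / 2) (by positivity)
    (by nlinarith [mul_pos hr hp]) (by positivity) hW
    (E := fun n => (nTermWidth (weightedNorm ω p) (weightedNorm η 2)
      (trigSystem d) n).toReal ^ p) ?_ ?_
  · have h2 := hmain.rpow_const (p := 1 / p) (Or.inr (by positivity))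
    refine h2.congr fun n => ?_
    rw [Real.mul_rpow (by positivity) (by positivity), ← Real.rpow_mul ENNReal.toReal_nonneg,
      ← Real.rpow_mul (by positivity), mul_one_div_cancel hp.ne', Real.rpow_one, mul_one_div]
  · intro n m hnm
    have hcard : ((Finset.range m).image e).card = m := by
      rw [Finset.card_image_of_injective _ he, Finset.card_range]
    have h := le_nTermWidth hω hη hp (n := n) (M := (Finset.range m).image e) (by rwa [hcard])
    rw [hcard, Finset.sum_image fun i _ j _ hij => he hij] at h
    have hmn : (0 : ℝ) ≤ (m : ℝ) - n := by rw [sub_nonneg]; exact_mod_cast hnm.le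
    have hW0 : 0 ≤ ∑ i ∈ Finset.range m, (ω (e i) / η (e i)) ^ p :=
      Finset.sum_nonneg fun i _ => Real.rpow_nonneg (div_pos (hω _) (hη _)).le _
    rw [ENNReal.ofReal_le_iff_le_toReal (nTermWidth_ne_top hη hηω hp hp2 n)] at h
    have h3 := Real.rpow_le_rpow (by positivity) h hp.le
    rwa [← Real.rpow_mul (by positivity), one_div_mul_cancel hp.ne', Real.rpow_one] at h3
  · intro n A hA hbound
    have h := nTermWidth_le hη hηω hp hp2 (n := n) hA fun M hM => ?_
    · have h2 := ENNReal.toReal_le_of_le_ofReal (by positivity) h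
      have h3 := Real.rpow_le_rpow ENNReal.toReal_nonneg h2 hp.le
      rwa [← Real.rpow_mul hA, one_div_mul_cancel hp.ne', Real.rpow_one] at h3
    · refine (hbound M.card hM).trans (mul_le_mul_of_nonneg_left ?_ hA)
      exact sum_range_increasing_enumeration_le (v := fun k => (ω k / η k) ^ p) hmin' _ M rfl

end WidthBounds

/-! ### Counting integers below a function of linear growth. -/

section OneDimensionalCount

lemma setOf_abs_intCast_le_eq (y : ℝ) :
    {x : ℤ | |(x : ℝ)| ≤ y} = ((Finset.Icc (-⌊y⌋) ⌊y⌋ : Finset ℤ) : Set ℤ) := by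
  ext x
  simp only [Finset.coe_Icc, Set.mem_Icc]
  change |(x : ℝ)| ≤ y ↔ _
  rw [abs_le, neg_le, Int.le_floor]
  constructor
  · rintro ⟨h1, h2⟩
    refine ⟨?_, h2⟩
    rw [neg_le, Int.le_floor]
    push_cast
    linarith
  · rintro ⟨h1, h2⟩
    refine ⟨?_, h2⟩
    rw [neg_le, Int.le_floor] at h1
    push_cast at h1
    linarith

lemma finite_abs_intCast_le (y : ℝ) : {x : ℤ | |(x : ℝ)| ≤ y}.Finite := by
  rw [setOf_abs_intCast_le_eq]
  exact Finset.finite_toSet _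

lemma ncard_abs_intCast_le {y : ℝ} (hy : 0 ≤ y) :
    ({x : ℤ | |(x : ℝ)| ≤ y}.ncard : ℝ) = 2 * (⌊y⌋ : ℝ) + 1 := by
  rw [setOf_abs_intCast_le_eq, Set.ncard_coe_finset, Int.card_Icc]
  have h : 0 ≤ ⌊y⌋ := Int.floor_nonneg.2 hy
  have h2 : (((⌊y⌋ + 1 - -⌊y⌋).toNat : ℤ) : ℝ) = 2 * (⌊y⌋ : ℝ) + 1 := by
    rw [Int.toNat_of_nonneg (by omega)]
    push_cast
    ring
  exact_mod_cast h2

lemma tendsto_affine_div_atTop (a b : ℝ) :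
    Tendsto (fun T : ℝ => (a * T + b) / T) atTop (𝓝 a) := by
  have h : Tendsto (fun T : ℝ => a + b * T⁻¹) atTop (𝓝 a) := by
    simpa using (tendsto_inv_atTop_zero.const_mul b).const_add a
  refine h.congr' ?_
  filter_upwards [eventually_gt_atTop 0] with T hT
  field_simp

/-- If `f(x) ∼ G |x|`, then `#{x : ℤ | f x ≤ T} ∼ 2 T / G`, also if finitely many `x` are left
out. -/
lemma tendsto_ncard_div_of_tendsto_div_abs {f : ℤ → ℝ} {G : ℝ} (hG : 0 < G) {Q : ℤ → Prop}
    (hQ : ∀ᶠ x in cofinite, Q x)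
    (hf : Tendsto (fun x : ℤ => f x / |(x : ℝ)|) cofinite (𝓝 G)) :
    Tendsto (fun T : ℝ => ({x : ℤ | Q x ∧ f x ≤ T}.ncard : ℝ) / T) atTop (𝓝 (2 / G)) := by
  have hne : ∀ᶠ x : ℤ in cofinite, x ≠ 0 := by
    simpa using (Set.finite_singleton (0 : ℤ)).compl_mem_cofinite
  have hup : ∀ G', 0 < G' → G' < G → ∃ X : Set ℤ, X.Finite ∧ ∀ T,
      {x : ℤ | Q x ∧ f x ≤ T} ⊆ X ∪ {x : ℤ | |(x : ℝ)| ≤ T / G'} := by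
    intro G' h0 h1
    refine ⟨_, eventually_cofinite.1 ((hf.eventually_const_lt h1).and hne), fun T x hx => ?_⟩
    by_cases hX : G' < f x / |(x : ℝ)| ∧ x ≠ 0
    · right
      have hx0 : 0 < |(x : ℝ)| := abs_pos.2 (by exact_mod_cast hX.2)
      have h2 := hX.1
      rw [lt_div_iff₀ hx0] at h2
      change |(x : ℝ)| ≤ T / G'
      rw [le_div_iff₀ h0]
      have := hx.2
      linarith
    · left
      exact hX
  refine tendsto_order.2 ⟨fun y hy => ?_, fun y hy => ?_⟩
  · obtain ⟨G', h1, h2⟩ : ∃ G', G < G' ∧ y < 2 / G' := by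
      have hcont : Tendsto (fun t : ℝ => 2 / t) (𝓝[>] G) (𝓝 (2 / G)) :=
        (tendsto_const_nhds.div tendsto_id hG.ne').mono_left nhdsWithin_le_nhds
      have h3 : ∀ᶠ t in 𝓝[>] G, G < t := eventually_mem_nhdsWithin
      exact (h3.and (hcont.eventually_const_lt hy)).exists
    have hG' : 0 < G' := hG.trans h1
    -- Needed only for finiteness of the sublevel sets, since `ncard` is 0 on infinite sets. Any
    -- positive constant below G would do.
    obtain ⟨Y, hYfin, hY⟩ := hup (G / 2) (by linarith) (by linarith)
    have hX := eventually_cofinite.1 ((hf.eventually_lt_const h1).and (hne.and hQ))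
    set X := {x : ℤ | ¬ (f x / |(x : ℝ)| < G' ∧ x ≠ 0 ∧ Q x)} with hXdef
    have hlim := tendsto_affine_div_atTop (2 / G') (-1 - X.ncard)
    filter_upwards [hlim.eventually_const_lt h2, eventually_gt_atTop 0] with T hT hT0
    refine hT.trans_le (div_le_div_of_nonneg_right ?_ hT0.le)
    have hsub : {x : ℤ | |(x : ℝ)| ≤ T / G'} ⊆ X ∪ {x : ℤ | Q x ∧ f x ≤ T} := by
      intro x hx
      by_cases hxX : x ∈ X
      · exact Or.inl hxX
      · right
        have h3 : f x / |(x : ℝ)| < G' ∧ x ≠ 0 ∧ Q x := not_not.1 hxX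
        have hx0 : 0 < |(x : ℝ)| := abs_pos.2 (by exact_mod_cast h3.2.1)
        have h4 := h3.1
        rw [div_lt_iff₀ hx0] at h4
        have hx : |(x : ℝ)| ≤ T / G' := hx
        rw [le_div_iff₀ hG'] at hx
        exact ⟨h3.2.2, by linarith⟩
    have hfin : {x : ℤ | Q x ∧ f x ≤ T}.Finite :=
      (hYfin.union (finite_abs_intCast_le _)).subset (hY T)
    have hle := (Set.ncard_le_ncard hsub (hX.union hfin)).trans (Set.ncard_union_le _ _)
    have hle' : ({x : ℤ | |(x : ℝ)| ≤ T / G'}.ncard : ℝ)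
        ≤ X.ncard + ({x : ℤ | Q x ∧ f x ≤ T}.ncard : ℝ) := by exact_mod_cast hle
    rw [ncard_abs_intCast_le (by positivity)] at hle'
    have := Int.sub_one_lt_floor (T / G')
    have h5 : 2 / G' * T = 2 * (T / G') := by ring
    rw [h5]
    linarith
  · obtain ⟨G', h1, h0, h2⟩ : ∃ G', G' < G ∧ 0 < G' ∧ 2 / G' < y := by
      have hcont : Tendsto (fun t : ℝ => 2 / t) (𝓝[<] G) (𝓝 (2 / G)) :=
        (tendsto_const_nhds.div tendsto_id hG.ne').mono_left nhdsWithin_le_nhds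
      have h3 : ∀ᶠ t in 𝓝[<] G, t < G := eventually_mem_nhdsWithin
      have h4 : ∀ᶠ t in 𝓝[<] G, 0 < t := (eventually_gt_nhds hG).filter_mono nhdsWithin_le_nhds
      exact (h3.and (h4.and (hcont.eventually_lt_const hy))).exists
    obtain ⟨X, hXfin, hX⟩ := hup G' h0 h1
    have hlim := tendsto_affine_div_atTop (2 / G') (1 + X.ncard)
    filter_upwards [hlim.eventually_lt_const h2, eventually_gt_atTop 0] with T hT hT0
    refine lt_of_le_of_lt (div_le_div_of_nonneg_right ?_ hT0.le) hT
    have hle := (Set.ncard_le_ncard (hX T) (hXfin.union (finite_abs_intCast_le _))).trans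
      (Set.ncard_union_le _ _)
    have hle' : ({x : ℤ | Q x ∧ f x ≤ T}.ncard : ℝ)
        ≤ X.ncard + ({x : ℤ | |(x : ℝ)| ≤ T / G'}.ncard : ℝ) := by exact_mod_cast hle
    rw [ncard_abs_intCast_le (by positivity)] at hle'
    have := Int.floor_le (T / G')
    have h5 : 2 / G' * T = 2 * (T / G') := by ring
    rw [h5]
    linarith

lemma tendsto_abs_intCast_cofinite : Tendsto (fun x : ℤ => |(x : ℝ)|) cofinite atTop := by
  refine tendsto_atTop.2 fun b => eventually_cofinite.2 ?_
  refine (finite_abs_intCast_le b).subset fun x hx => ?_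
  exact (not_le.1 hx).le

end OneDimensionalCount

/-! ### Fibrewise counting and product sums. -/

section Fibres

variable {n : ℕ}

/-- Counting a finite subset of `ℤ^{n+1}` by its fibres over the coordinates other than `i`. -/
lemma ncard_eq_tsum_fibres (i : Fin (n + 1)) {A : Set (Fin (n + 1) → ℤ)} (hA : A.Finite) :
    (A.ncard : ℝ) = ∑' b : Fin n → ℤ, ({x : ℤ | i.insertNth x b ∈ A}.ncard : ℝ) := by
  classical
  have hfib : ∀ b : Fin n → ℤ, {x : ℤ | i.insertNth x b ∈ A}.ncard
      = (hA.toFinset.filter fun k => i.removeNth k = b).card := by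
    intro b
    have hinj : Function.Injective fun x : ℤ => (i.insertNth x b : Fin (n + 1) → ℤ) := by
      intro x y hxy
      have := congrFun hxy i
      simpa using this
    rw [← Set.ncard_image_of_injective _ hinj, ← Set.ncard_coe_finset]
    congr 1
    ext k
    simp only [Set.mem_image, Finset.coe_filter, Set.Finite.mem_toFinset]
    constructor
    · rintro ⟨x, hx, rfl⟩
      exact ⟨hx, by simp⟩
    · rintro ⟨hk, rfl⟩
      refine ⟨k i, ?_, by simp⟩
      change i.insertNth (k i) (i.removeNth k) ∈ A
      rwa [Fin.insertNth_self_removeNth]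
  rw [tsum_eq_sum (s := hA.toFinset.image i.removeNth)]
  · rw [Set.ncard_eq_toFinset_card _ hA, Finset.card_eq_sum_card_image i.removeNth, Nat.cast_sum]
    exact Finset.sum_congr rfl fun b _ => by rw [hfib]
  · intro b hb
    rw [hfib, Nat.cast_eq_zero, Finset.card_eq_zero, Finset.filter_eq_empty_iff]
    rintro k hk rfl
    exact hb (Finset.mem_image_of_mem _ hk)

/-- Source of the power (2S+1)^{d-1}: one coordinate is split off at a time, and nonnegativity makes
the product family summable. -/
lemma hasSum_prod_pi {h : ℤ → ℝ} (h0 : ∀ x, 0 ≤ h x) {H : ℝ} (hH : HasSum h H) (n : ℕ) :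
    HasSum (fun k : Fin n → ℤ => ∏ j, h (k j)) (H ^ n) := by
  induction n with
  | zero => simp
  | succ n ih =>
    rw [← (Fin.insertNthEquiv (fun _ => ℤ) 0).hasSum_iff, pow_succ']
    have hs : Summable fun x : ℤ × (Fin n → ℤ) => h x.1 * ∏ j, h (x.2 j) :=
      Summable.mul_of_nonneg (g := fun k : Fin n → ℤ => ∏ j, h (k j)) hH.summable ih.summable h0
        fun k => Finset.prod_nonneg fun j _ => h0 (k j)
    have hcomp : (fun k : Fin (n + 1) → ℤ => ∏ j, h (k j)) ∘ (Fin.insertNthEquiv (fun _ => ℤ) 0)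
        = fun x : ℤ × (Fin n → ℤ) => h x.1 * ∏ j, h (x.2 j) := by
      funext x
      simp [Fin.insertNthEquiv, Fin.prod_univ_succ]
    rw [hcomp]
    exact HasSum.mul (f := h) (g := fun k : Fin n → ℤ => ∏ j, h (k j)) hH ih hs

end Fibres

/-! ### Counting lattice points with bounded quotient weight. -/

section QuotientWeight

lemma one_add_sum_le_prod {ι : Type*} (A : Finset ι) {f : ι → ℝ} (hf : ∀ j, 0 ≤ f j) :
    1 + ∑ j ∈ A, f j ≤ ∏ j ∈ A, (1 + f j) := by
  classical
  induction A using Finset.induction_on with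
  | empty => simp
  | insert a A ha ih =>
    rw [Finset.sum_insert ha, Finset.prod_insert ha]
    have h1 : 0 ≤ ∑ j ∈ A, f j := Finset.sum_nonneg fun j _ => hf j
    nlinarith [mul_nonneg (hf a) h1, mul_le_mul_of_nonneg_left ih (hf a)]

/-- The normalized quotient `∏_j (1+k_j^2)^α / (1+∑_j k_j^2)^{α-1/2}`, of linear growth along the
coordinate axes. -/
noncomputable def quotientWeight {d : ℕ} (α : ℝ) (k : Fin d → ℤ) : ℝ :=
  (∏ j, (1 + (k j : ℝ) ^ 2)) ^ α / (1 + ∑ j, (k j : ℝ) ^ 2) ^ (α - 1 / 2)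

variable {d n : ℕ} {α : ℝ}

/-- With E = 1 + ∑ k_j^2 ≤ P = ∏(1+k_j^2), one has P^α/E^{α-1/2} ≥ E^{1/2}. This makes all sublevel
sets finite. -/
lemma abs_le_quotientWeight (hα : 1 / 2 < α) (k : Fin d → ℤ) (i : Fin d) :
    |(k i : ℝ)| ≤ quotientWeight α k := by
  have hE : (0 : ℝ) < 1 + ∑ j, (k j : ℝ) ^ 2 := by positivity
  have hEP := one_add_sum_le_prod (Finset.univ : Finset (Fin d)) (f := fun j => (k j : ℝ) ^ 2)
    fun j => sq_nonneg _
  have h1 : (1 + ∑ j, (k j : ℝ) ^ 2) ^ (1 / 2 : ℝ) ≤ quotientWeight α k := by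
    unfold quotientWeight
    rw [le_div_iff₀ (by positivity), ← Real.rpow_add hE, add_sub_cancel]
    exact Real.rpow_le_rpow hE.le hEP (by linarith)
  refine le_trans ?_ h1
  rw [← Real.sqrt_eq_rpow, ← Real.sqrt_sq_eq_abs]
  refine Real.sqrt_le_sqrt ?_
  have : (k i : ℝ) ^ 2 ≤ ∑ j, (k j : ℝ) ^ 2 :=
    Finset.single_le_sum (f := fun j => (k j : ℝ) ^ 2) (fun j _ => sq_nonneg _) (Finset.mem_univ i)
  linarith

lemma finite_quotientWeight_le (hα : 1 / 2 < α) (T : ℝ) :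
    {k : Fin d → ℤ | quotientWeight α k ≤ T}.Finite := by
  refine (Set.finite_Icc (fun _ : Fin d => -⌊T⌋) (fun _ => ⌊T⌋)).subset fun k hk => ?_
  have h : ∀ i, -⌊T⌋ ≤ k i ∧ k i ≤ ⌊T⌋ := by
    intro i
    have h1 : k i ∈ {x : ℤ | |(x : ℝ)| ≤ T} := (abs_le_quotientWeight hα k i).trans hk
    rw [setOf_abs_intCast_le_eq] at h1
    simpa using h1
  exact ⟨fun i => (h i).1, fun i => (h i).2⟩

lemma quotientWeight_insertNth (i : Fin (n + 1)) (x : ℤ) (b : Fin n → ℤ) :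
    quotientWeight α (i.insertNth x b : Fin (n + 1) → ℤ) =
      (∏ j, (1 + (b j : ℝ) ^ 2)) ^ α * ((1 + (x : ℝ) ^ 2) ^ α /
        (1 + (x : ℝ) ^ 2 + ∑ j, (b j : ℝ) ^ 2) ^ (α - 1 / 2)) := by
  unfold quotientWeight
  rw [Fin.prod_univ_succAbove _ i, Fin.sum_univ_succAbove _ i]
  simp only [Fin.insertNth_apply_same, Fin.insertNth_apply_succAbove]
  rw [Real.mul_rpow (by positivity) (Finset.prod_nonneg fun j _ => by positivity), add_assoc]
  ring

/-- The fixed coordinates enter the sum only through the constant B, negligible against x^2; what is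
left is |x|^{2α-(2α-1)}. -/
lemma tendsto_axis_weight_div_abs (B : ℝ) (hB : 0 ≤ B) :
    Tendsto (fun x : ℤ => ((1 + (x : ℝ) ^ 2) ^ α / (1 + (x : ℝ) ^ 2 + B) ^ (α - 1 / 2)) / |(x : ℝ)|)
      cofinite (𝓝 1) := by
  have habs := tendsto_abs_intCast_cofinite
  have hratio : ∀ C : ℝ, Tendsto (fun x : ℤ => C * (|(x : ℝ)|⁻¹) ^ 2 + 1) cofinite (𝓝 1) := by
    intro C
    have h := (((tendsto_inv_atTop_zero.comp habs).pow 2).const_mul C).add_const 1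
    simpa using h
  have h1 := ((hratio 1).rpow_const (p := α) (Or.inl one_ne_zero)).div
    ((hratio (1 + B)).rpow_const (p := α - 1 / 2) (Or.inl one_ne_zero)) (by simp)
  simp only [Real.one_rpow, div_one] at h1
  refine h1.congr' ?_
  filter_upwards [habs.eventually_gt_atTop 0] with x hx
  simp only [Pi.div_apply]
  set t := |(x : ℝ)| with ht
  have hsq : (x : ℝ) ^ 2 = t ^ 2 := (sq_abs _).symm
  rw [hsq]
  have e1 : 1 * t⁻¹ ^ 2 + 1 = (1 + t ^ 2) / t ^ 2 := by field_simp
  have e2 : (1 + B) * t⁻¹ ^ 2 + 1 = (1 + t ^ 2 + B) / t ^ 2 := by field_simp; ring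
  rw [e1, e2, Real.div_rpow (by positivity) (by positivity),
    Real.div_rpow (by positivity) (by positivity)]
  have e3 : (t ^ 2) ^ α = (t ^ 2) ^ (α - 1 / 2) * t := by
    rw [Real.rpow_sub (by positivity), ← Real.sqrt_eq_rpow, Real.sqrt_sq hx.le]
    field_simp
  rw [e3]
  have : (0 : ℝ) < 1 + t ^ 2 + B := by positivity
  field_simp

/-- On the region where the coordinate `x` dominates, the fibre counts have a summable majorant. -/
lemma ncard_fibre_le (hα : 1 / 2 < α) (i : Fin (n + 1)) (b : Fin n → ℤ) {Q : ℤ → Prop}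
    (hQ : ∀ x, Q x → ∀ j, |b j| ≤ |x|) {T : ℝ} (hT : 0 < T) :
    ({x : ℤ | Q x ∧ quotientWeight α (i.insertNth x b : Fin (n + 1) → ℤ) ≤ T}.ncard : ℝ) / T ≤
      3 * ((n : ℝ) + 1) ^ (α - 1 / 2) / (∏ j, (1 + (b j : ℝ) ^ 2)) ^ α := by
  set G := (∏ j, (1 + (b j : ℝ) ^ 2)) ^ α with hG
  have hG0 : 0 < G := Real.rpow_pos_of_pos (Finset.prod_pos fun j _ => by positivity) _
  set D := ((n : ℝ) + 1) ^ (α - 1 / 2) with hD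
  have hD0 : 0 < D := by positivity
  -- Dominance of x gives 1 + x² + ∑ b_j² ≤ (n+1)(1+x²), so the weight on the fibre is at least G
  -- √(1+x²)/D.
  have hkey : ∀ x, Q x → quotientWeight α (i.insertNth x b : Fin (n + 1) → ℤ) ≤ T →
      √(1 + (x : ℝ) ^ 2) ≤ D * T / G := by
    intro x hx hle
    have hx1 : (0 : ℝ) < 1 + (x : ℝ) ^ 2 := by positivity
    have hsum : 1 + (x : ℝ) ^ 2 + ∑ j, (b j : ℝ) ^ 2 ≤ ((n : ℝ) + 1) * (1 + (x : ℝ) ^ 2) := by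
      have h1 : ∑ j, (b j : ℝ) ^ 2 ≤ ∑ _j : Fin n, (x : ℝ) ^ 2 := by
        refine Finset.sum_le_sum fun j _ => sq_le_sq.2 ?_
        have := hQ x hx j
        exact_mod_cast this
      rw [Finset.sum_const, Finset.card_univ, Fintype.card_fin, nsmul_eq_mul] at h1
      have : (0 : ℝ) ≤ n := n.cast_nonneg
      linarith
    rw [quotientWeight_insertNth, ← hG] at hle
    have hsum0 : 0 < 1 + (x : ℝ) ^ 2 + ∑ j, (b j : ℝ) ^ 2 := by positivity
    have h2 : √(1 + (x : ℝ) ^ 2) / D ≤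
        (1 + (x : ℝ) ^ 2) ^ α / (1 + (x : ℝ) ^ 2 + ∑ j, (b j : ℝ) ^ 2) ^ (α - 1 / 2) := by
      rw [div_le_div_iff₀ hD0 (by positivity)]
      calc √(1 + (x : ℝ) ^ 2) * (1 + (x : ℝ) ^ 2 + ∑ j, (b j : ℝ) ^ 2) ^ (α - 1 / 2)
          ≤ √(1 + (x : ℝ) ^ 2) * (((n : ℝ) + 1) * (1 + (x : ℝ) ^ 2)) ^ (α - 1 / 2) := by
            gcongr
        _ = (1 + (x : ℝ) ^ 2) ^ α * D := by
            rw [Real.mul_rpow (by positivity) hx1.le, ← hD, Real.rpow_sub hx1, Real.sqrt_eq_rpow]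
            field_simp
    have h3 := (mul_le_mul_of_nonneg_left h2 hG0.le).trans hle
    rw [le_div_iff₀ hG0]
    rw [mul_div_assoc', div_le_iff₀ hD0] at h3
    linarith
  rw [div_le_div_iff₀ hT hG0]
  by_cases hne : ∃ x, Q x ∧ quotientWeight α (i.insertNth x b : Fin (n + 1) → ℤ) ≤ T
  · obtain ⟨x₀, hx₀⟩ := hne
    -- A single point in the fibre forces y = DT/G ≥ 1, so the additive 1 in 2⌊y⌋+1 is absorbed into
    -- 3y. Left alone it would not be summable over b.
    have h1 : 1 ≤ D * T / G := by
      refine le_trans ?_ (hkey x₀ hx₀.1 hx₀.2)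
      rw [Real.one_le_sqrt]
      nlinarith [sq_nonneg (x₀ : ℝ)]
    have hsub : {x : ℤ | Q x ∧ quotientWeight α (i.insertNth x b : Fin (n + 1) → ℤ) ≤ T} ⊆
        {x : ℤ | |(x : ℝ)| ≤ D * T / G} := by
      intro x hx
      refine le_trans ?_ (hkey x hx.1 hx.2)
      exact Real.abs_le_sqrt (by linarith)
    have hle := Set.ncard_le_ncard hsub (finite_abs_intCast_le _)
    have hle' : ({x : ℤ | Q x ∧ quotientWeight α (i.insertNth x b : Fin (n + 1) → ℤ) ≤ T}.ncard : ℝ)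
      ≤ ({x : ℤ | |(x : ℝ)| ≤ D * T / G}.ncard : ℝ) := by exact_mod_cast hle
    rw [ncard_abs_intCast_le (by positivity)] at hle'
    have hfl := Int.floor_le (D * T / G)
    have h2 : ({x : ℤ | Q x ∧ quotientWeight α (i.insertNth x b : Fin (n + 1) → ℤ) ≤ T}.ncard : ℝ)
        ≤ 3 * (D * T / G) := by linarith
    calc _ ≤ 3 * (D * T / G) * G := mul_le_mul_of_nonneg_right h2 hG0.le
      _ = 3 * D * T := by field_simp
  · have : {x : ℤ | Q x ∧ quotientWeight α (i.insertNth x b : Fin (n + 1) → ℤ) ≤ T} = ∅ := by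
      refine Set.eq_empty_iff_forall_notMem.2 fun x hx => hne ⟨x, hx⟩
    rw [this, Set.ncard_empty, Nat.cast_zero, zero_mul]
    positivity

/-- The count over the region where the `i`-th coordinate dominates; `R` is `≤` or `<`. -/
lemma tendsto_ncard_dominant_div (hα : 1 / 2 < α) {H : ℝ}
    (hH : HasSum (fun x : ℤ => 1 / (1 + (x : ℝ) ^ 2) ^ α) H) (i : Fin (n + 1)) {R : ℤ → ℤ → Prop}
    (hRle : ∀ a b, R a b → a ≤ b) (hRlt : ∀ a b, a < b → R a b) :
    Tendsto (fun T : ℝ => ({k : Fin (n + 1) → ℤ | (∀ j, R |k (i.succAbove j)| |k i|) ∧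
      quotientWeight α k ≤ T}.ncard : ℝ) / T) atTop (𝓝 (2 * H ^ n)) := by
  have hS : HasSum (fun b : Fin n → ℤ => 1 / (∏ j, (1 + (b j : ℝ) ^ 2)) ^ α) (H ^ n) := by
    have := hasSum_prod_pi (fun x => by positivity) hH n
    convert this using 1
    funext b
    rw [Finset.prod_div_distrib, Finset.prod_const_one,
      Real.finsetProd_rpow _ _ fun j _ => by positivity]
  have hfib : ∀ T (b : Fin n → ℤ),
      {x : ℤ | (i.insertNth x b : Fin (n + 1) → ℤ) ∈ {k : Fin (n + 1) → ℤ |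
        (∀ j, R |k (i.succAbove j)| |k i|) ∧ quotientWeight α k ≤ T}} =
      {x : ℤ | (∀ j, R |b j| |x|) ∧
        quotientWeight α (i.insertNth x b : Fin (n + 1) → ℤ) ≤ T} := by
    intro T b
    ext x
    change ((∀ j, R |(i.insertNth x b : Fin (n + 1) → ℤ) (i.succAbove j)|
      |(i.insertNth x b : Fin (n + 1) → ℤ) i|) ∧ _) ↔ _
    simp only [Fin.insertNth_apply_same, Fin.insertNth_apply_succAbove]
    rfl
  -- The limit T → ∞ is exchanged with the sum over fibres; restricting to dominant x is what
  -- supplies the majorant.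
  have hdom := tendsto_tsum_of_dominated_convergence (𝓕 := atTop)
    (f := fun (T : ℝ) (b : Fin n → ℤ) => ({x : ℤ | (∀ j, R |b j| |x|) ∧
      quotientWeight α (i.insertNth x b : Fin (n + 1) → ℤ) ≤ T}.ncard : ℝ) / T)
    (g := fun b => 2 / (∏ j, (1 + (b j : ℝ) ^ 2)) ^ α)
    (bound := fun b => 3 * ((n : ℝ) + 1) ^ (α - 1 / 2) / (∏ j, (1 + (b j : ℝ) ^ 2)) ^ α)
    ?_ ?_ ?_
  · have h2 : ∑' b : Fin n → ℤ, 2 / (∏ j, (1 + (b j : ℝ) ^ 2)) ^ α = 2 * H ^ n := by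
      rw [← (hS.mul_left 2).tsum_eq]
      exact tsum_congr fun b => by ring
    rw [h2] at hdom
    refine hdom.congr fun T => ?_
    rw [tsum_div_const, ncard_eq_tsum_fibres i
      ((finite_quotientWeight_le hα T).subset fun k hk => hk.2)]
    simp only [hfib]
  · have := hS.summable.mul_left (3 * ((n : ℝ) + 1) ^ (α - 1 / 2))
    simpa only [mul_one_div] using this
  · intro b
    have hG0 : 0 < (∏ j, (1 + (b j : ℝ) ^ 2)) ^ α :=
      Real.rpow_pos_of_pos (Finset.prod_pos fun j _ => by positivity) _
    refine tendsto_ncard_div_of_tendsto_div_abs hG0 (Q := fun x => ∀ j, R |b j| |x|) ?_ ?_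
    · refine Filter.eventually_all.2 fun j => ?_
      filter_upwards [tendsto_abs_intCast_cofinite.eventually_gt_atTop |(b j : ℝ)|] with x hx
      exact hRlt _ _ (by exact_mod_cast hx)
    · have h1 := (tendsto_axis_weight_div_abs (α := α) (∑ j, (b j : ℝ) ^ 2)
        (by positivity)).const_mul ((∏ j, (1 + (b j : ℝ) ^ 2)) ^ α)
      rw [mul_one] at h1
      refine h1.congr fun x => ?_
      rw [quotientWeight_insertNth, mul_div_assoc]
  · filter_upwards [eventually_gt_atTop 0] with T hT b
    rw [Real.norm_of_nonneg (by positivity)]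
    exact ncard_fibre_le hα i b (fun x hx j => hRle _ _ (hx j)) hT

/-- Regions where one coordinate strictly dominates are disjoint, while those with weak dominance
cover everything. Both families have the same asymptotic count, so ties do not matter and the full
count is squeezed. -/
lemma tendsto_ncard_quotientWeight_div (hα : 1 / 2 < α) {H : ℝ}
    (hH : HasSum (fun x : ℤ => 1 / (1 + (x : ℝ) ^ 2) ^ α) H) :
    Tendsto (fun T : ℝ => ({k : Fin (n + 1) → ℤ | quotientWeight α k ≤ T}.ncard : ℝ) / T) atTop
      (𝓝 (2 * ((n : ℝ) + 1) * H ^ n)) := by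
  have hlim : ∀ {R : ℤ → ℤ → Prop}, (∀ a b, R a b → a ≤ b) → (∀ a b, a < b → R a b) →
      Tendsto (fun T : ℝ => ((∑ i : Fin (n + 1), {k : Fin (n + 1) → ℤ |
        (∀ j, R |k (i.succAbove j)| |k i|) ∧ quotientWeight α k ≤ T}.ncard : ℕ) : ℝ) / T) atTop
        (𝓝 (2 * ((n : ℝ) + 1) * H ^ n)) := by
    intro R hRle hRlt
    have h := tendsto_finsetSum (Finset.univ : Finset (Fin (n + 1)))
      fun i _ => tendsto_ncard_dominant_div hα hH i hRle hRlt
    have h2 : ∑ _i : Fin (n + 1), 2 * H ^ n = 2 * ((n : ℝ) + 1) * H ^ n := by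
      rw [Finset.sum_const, Finset.card_univ, Fintype.card_fin, nsmul_eq_mul]
      push_cast
      ring
    rw [h2] at h
    refine h.congr fun T => ?_
    rw [Nat.cast_sum, Finset.sum_div]
  -- Double counting: each k is counted once for every coordinate that dominates in the sense of R.
  have hcount : ∀ (R : ℤ → ℤ → Prop) [DecidableRel R] (T : ℝ), ∑ i : Fin (n + 1), {k : Fin (n + 1) → ℤ |
        (∀ j, R |k (i.succAbove j)| |k i|) ∧ quotientWeight α k ≤ T}.ncard =
      ∑ k ∈ (finite_quotientWeight_le (d := n + 1) hα T).toFinset,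
        (Finset.univ.filter fun i : Fin (n + 1) => ∀ j, R |k (i.succAbove j)| |k i|).card := by
    intro R _ T
    simp only [Finset.card_filter]
    rw [Finset.sum_comm]
    refine Finset.sum_congr rfl fun i _ => ?_
    rw [← Finset.card_filter, ← Set.ncard_coe_finset]
    congr 1
    ext k
    simp only [Finset.coe_filter, Set.Finite.mem_toFinset]
    exact and_comm
  have hN : ∀ T, {k : Fin (n + 1) → ℤ | quotientWeight α k ≤ T}.ncard =
      ∑ k ∈ (finite_quotientWeight_le (d := n + 1) hα T).toFinset, 1 := by
    intro T
    rw [Set.ncard_eq_toFinset_card _ (finite_quotientWeight_le hα T), Finset.card_eq_sum_ones]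
  refine tendsto_of_tendsto_of_tendsto_of_le_of_le' (hlim (R := fun a b => a < b)
    (fun _ _ => le_of_lt) fun _ _ h => h) (hlim (R := fun a b => a ≤ b) (fun _ _ h => h)
    fun _ _ => le_of_lt) ?_ ?_
  · filter_upwards [eventually_gt_atTop 0] with T hT
    refine div_le_div_of_nonneg_right ?_ hT.le
    rw [hcount, hN, Nat.cast_le]
    refine Finset.sum_le_sum fun k _ => Finset.card_le_one.2 fun i hi i' hi' => ?_
    by_contra hne
    obtain ⟨j, hj⟩ := Fin.exists_succAbove_eq (Ne.symm hne)
    obtain ⟨j', hj'⟩ := Fin.exists_succAbove_eq hne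
    have h1 := (Finset.mem_filter.1 hi).2 j
    have h2 := (Finset.mem_filter.1 hi').2 j'
    rw [hj] at h1
    rw [hj'] at h2
    exact lt_asymm h1 h2
  · filter_upwards [eventually_gt_atTop 0] with T hT
    refine div_le_div_of_nonneg_right ?_ hT.le
    rw [hcount, hN, Nat.cast_le]
    refine Finset.sum_le_sum fun k _ => Finset.card_pos.2 ?_
    obtain ⟨i, -, hi⟩ := Finset.exists_max_image (Finset.univ : Finset (Fin (n + 1)))
      (fun i => |k i|) Finset.univ_nonempty
    exact ⟨i, Finset.mem_filter.2 ⟨Finset.mem_univ _, fun j => hi _ (Finset.mem_univ _)⟩⟩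

end QuotientWeight

/-! ### The weights of the theorem and the series S. -/

section Weights

variable {d : ℕ} {s : ℝ}

lemma mixWeight_eq (s : ℝ) (k : Fin d → ℤ) :
    mixWeight s k = (∏ j, (1 + (k j : ℝ) ^ 2)) ^ (s / 2) :=
  Real.finsetProd_rpow _ _ (fun j _ => by positivity) _

lemma energyWeight_pos (k : Fin d → ℤ) : 0 < energyWeight k := by
  unfold energyWeight
  positivity

lemma energyWeight_le_mixWeight (hs : 1 < s) (k : Fin d → ℤ) : energyWeight k ≤ mixWeight s k := by
  have hEP := one_add_sum_le_prod (Finset.univ : Finset (Fin d)) (f := fun j => (k j : ℝ) ^ 2)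
    fun j => sq_nonneg _
  have hE : (1 : ℝ) ≤ 1 + ∑ j, (k j : ℝ) ^ 2 := by
    have : (0 : ℝ) ≤ ∑ j, (k j : ℝ) ^ 2 := by positivity
    linarith
  rw [mixWeight_eq]
  calc energyWeight k ≤ (∏ j, (1 + (k j : ℝ) ^ 2)) ^ (1 / 2 : ℝ) :=
        Real.rpow_le_rpow (by linarith) hEP (by norm_num)
    _ ≤ _ := Real.rpow_le_rpow_of_exponent_le (hE.trans hEP) (by linarith)

lemma quotientWeight_nonneg {α : ℝ} (k : Fin d → ℤ) : 0 ≤ quotientWeight α k := by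
  have : 0 ≤ ∏ j, (1 + (k j : ℝ) ^ 2) := Finset.prod_nonneg fun j _ => by positivity
  unfold quotientWeight
  positivity

/-- The value of α is dictated by α(s-1) = s/2, and then (α - 1/2)(s-1) = 1/2 holds automatically.
-/
lemma quotientWeight_rpow (hs : 1 < s) (k : Fin d → ℤ) :
    quotientWeight (s / (2 * (s - 1))) k ^ (s - 1) = mixWeight s k / energyWeight k := by
  have hP : 0 ≤ ∏ j, (1 + (k j : ℝ) ^ 2) := Finset.prod_nonneg fun j _ => by positivity
  have hE : 0 ≤ 1 + ∑ j, (k j : ℝ) ^ 2 := by positivity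
  have hs' : s - 1 ≠ 0 := by linarith
  unfold quotientWeight
  rw [mixWeight_eq, energyWeight, Real.div_rpow (by positivity) (by positivity),
    ← Real.rpow_mul hP, ← Real.rpow_mul hE]
  congr 2
  · field_simp
  · field_simp
    ring

lemma half_lt_exponent (hs : 1 < s) : 1 / 2 < s / (2 * (s - 1)) := by
  rw [div_lt_div_iff₀ (by norm_num) (by linarith)]
  linarith

lemma summable_sTerm (hs : 1 < s) : Summable (sTerm s) := by
  have h := half_lt_exponent hs
  set α := s / (2 * (s - 1)) with hα
  have h1 : Summable fun n : ℕ => 1 / (n : ℝ) ^ (2 * α) :=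
    Real.summable_one_div_nat_rpow.2 (by linarith)
  refine Summable.of_nonneg_of_le (fun i => ?_) (fun i => ?_) ((summable_nat_add_iff 1).2 h1)
  · unfold sTerm
    positivity
  · unfold sTerm
    rw [← hα]
    push_cast
    refine one_div_le_one_div_of_le (by positivity) ?_
    rw [Real.rpow_mul (by positivity), Real.rpow_two]
    exact Real.rpow_le_rpow (by positivity) (by linarith) (by linarith)

/-- The summand is even in x and equals 1 at x = 0. -/
lemma hasSum_int_sTerm (hs : 1 < s) :
    HasSum (fun x : ℤ => 1 / (1 + (x : ℝ) ^ 2) ^ (s / (2 * (s - 1)))) (2 * sSum s + 1) := by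
  have h : HasSum (sTerm s) (sSum s) := (summable_sTerm hs).hasSum
  set α := s / (2 * (s - 1)) with hα
  have h1 : HasSum (fun n : ℕ => 1 / (1 + (((n : ℤ) + 1 : ℤ) : ℝ) ^ 2) ^ α) (sSum s) := by
    convert h using 1
    funext n
    rw [sTerm, ← hα, add_comm (1 : ℝ)]
    push_cast
    rfl
  have h2 : HasSum (fun n : ℕ => 1 / (1 + ((-((n : ℤ) + 1) : ℤ) : ℝ) ^ 2) ^ α) (sSum s) := by
    convert h1 using 1
    funext n
    rw [Int.cast_neg, neg_sq]
  have h3 := HasSum.of_add_one_of_neg_add_one (f := fun x : ℤ => 1 / (1 + (x : ℝ) ^ 2) ^ α) h1 h2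
  have h4 : sSum s + 1 / (1 + ((0 : ℤ) : ℝ) ^ 2) ^ α + sSum s = 2 * sSum s + 1 := by
    simp
    ring
  rwa [h4] at h3

lemma sSum_nonneg (s : ℝ) : 0 ≤ sSum s :=
  tsum_nonneg fun i => by
    unfold sTerm
    positivity

lemma tendsto_mix_nTermWidth (hd : 1 ≤ d) (hs : 1 < s) {p : ℝ} (hp : 0 < p) (hp2 : p ≤ 2) :
    Tendsto (fun n : ℕ =>
      (nTermWidth (weightedNorm (mixWeight s) p) (hOneNorm d) (trigSystem d) n).toReal *
        (n : ℝ) ^ (((s - 1) * p + 1 - p / 2) / p)) atTop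
      (𝓝 (((p / 2) ^ (p / 2) * ((s - 1) * p + 1 - p / 2) ^ ((s - 1) * p + 1 - p / 2) /
        ((1 / (2 * (d : ℝ) * (2 * sSum s + 1) ^ ((d : ℝ) - 1))) ^ ((s - 1) * p) /
          ((s - 1) * p + 1) * ((s - 1) * p + 1) ^ ((s - 1) * p + 1))) ^ (1 / p))) := by
  have : NeZero d := ⟨by omega⟩
  have hS := sSum_nonneg s
  have hd' : (0 : ℝ) < d := by exact_mod_cast hd
  refine tendsto_nTermWidth energyWeight_pos (energyWeight_le_mixWeight hs) hp hp2
    (by linarith : 0 < s - 1) (by positivity) quotientWeight_nonneg (quotientWeight_rpow hs)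
    (finite_quotientWeight_le (half_lt_exponent hs)) ?_
  obtain ⟨n, rfl⟩ : ∃ n, d = n + 1 := ⟨d - 1, by omega⟩
  have h := tendsto_ncard_quotientWeight_div (n := n) (half_lt_exponent hs) (hasSum_int_sTerm hs)
  convert h using 2
  push_cast
  rw [add_sub_cancel_right, Real.rpow_natCast]

end Weights

/-! ### Simplification of the limit constants, and the theorem. -/

/-- The constant for `p = 2`. -/
lemma hMix_constant {s D H e : ℝ} (hs : 1 < s) (hD : 0 < D) (hH : 0 < H) :
    (((2 : ℝ) / 2) ^ ((2 : ℝ) / 2) * ((s - 1) * 2 + 1 - 2 / 2) ^ ((s - 1) * 2 + 1 - 2 / 2) /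
        ((1 / (D * H ^ e)) ^ ((s - 1) * 2) / ((s - 1) * 2 + 1) *
          ((s - 1) * 2 + 1) ^ ((s - 1) * 2 + 1))) ^ (1 / (2 : ℝ)) =
      ((s - 1) / (s - 1 / 2)) ^ (s - 1) * D ^ (s - 1) * H ^ ((s - 1) * e) := by
  have hr : 0 < s - 1 := by linarith
  have hh : 0 < s - 1 / 2 := by linarith
  have hK : 0 < D * H ^ e := by positivity
  have e1 : (s - 1) * 2 + 1 - 2 / 2 = (s - 1) * 2 := by ring
  have e2 : (s - 1) * 2 + 1 = 2 * (s - 1 / 2) := by ring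
  have hb : ((2 : ℝ) / 2) ^ ((2 : ℝ) / 2) = 1 := by norm_num
  have key : ((2 : ℝ) / 2) ^ ((2 : ℝ) / 2) * ((s - 1) * 2 + 1 - 2 / 2) ^ ((s - 1) * 2 + 1 - 2 / 2) /
        ((1 / (D * H ^ e)) ^ ((s - 1) * 2) / ((s - 1) * 2 + 1) *
          ((s - 1) * 2 + 1) ^ ((s - 1) * 2 + 1)) =
      ((s - 1) / (s - 1 / 2) * (D * H ^ e)) ^ ((s - 1) * 2) := by
    rw [hb, e1, Real.rpow_add (by positivity) ((s - 1) * 2), Real.rpow_one, e2, one_mul,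
      one_div, Real.inv_rpow hK.le, Real.mul_rpow (by positivity) hK.le,
      Real.div_rpow hr.le hh.le, Real.mul_rpow hr.le (by norm_num),
      Real.mul_rpow (by norm_num) hh.le]
    generalize s - 1 / 2 = u at hh ⊢
    field_simp
  rw [key, ← Real.rpow_mul (by positivity), show (s - 1) * 2 * (1 / 2) = s - 1 by ring,
    Real.mul_rpow (by positivity) hK.le, Real.mul_rpow hD.le (by positivity), ← Real.rpow_mul hH.le,
    mul_comm e, mul_assoc]

/-- The constant for `p = 1`. -/
lemma aMix_constant {s D H e : ℝ} (hs : 1 < s) (hD : 0 < D) (hH : 0 < H) :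
    (((1 : ℝ) / 2) ^ ((1 : ℝ) / 2) * ((s - 1) * 1 + 1 - 1 / 2) ^ ((s - 1) * 1 + 1 - 1 / 2) /
        ((1 / (D * H ^ e)) ^ ((s - 1) * 1) / ((s - 1) * 1 + 1) *
          ((s - 1) * 1 + 1) ^ ((s - 1) * 1 + 1))) ^ (1 / (1 : ℝ)) =
      (s - 1 / 2) ^ (s - 1 / 2) / (√2 * s ^ (s - 1)) * D ^ (s - 1) * H ^ ((s - 1) * e) := by
  have hs0 : 0 < s := by linarith
  have hK : 0 < D * H ^ e := by positivity
  have e1 : (s - 1) * 1 + 1 - 1 / 2 = s - 1 / 2 := by ring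
  have e2 : (s - 1) * 1 + 1 = s := by ring
  have hb : ((1 : ℝ) / 2) ^ ((1 : ℝ) / 2) = 1 / √2 := by
    rw [← Real.sqrt_eq_rpow, Real.sqrt_div zero_le_one, Real.sqrt_one]
  rw [hb, div_one, Real.rpow_one, e1, e2, mul_one, one_div (D * H ^ e), Real.inv_rpow hK.le,
    Real.mul_rpow hD.le (by positivity), ← Real.rpow_mul hH.le, mul_comm e]
  have e3 : s ^ s = s ^ (s - 1) * s := by
    rw [Real.rpow_sub_one hs0.ne']
    field_simp
  rw [e3]
  field_simp

end TrigApprox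

theorem theorem4p5 (d : ℕ) (hd : 1 ≤ d) (s : ℝ) (hs : 1 < s) :
    Summable (TrigApprox.sTerm s) ∧
    (∀ n : ℕ, TrigApprox.nTermWidth (TrigApprox.hMixNorm d s) (TrigApprox.hOneNorm d)
      (TrigApprox.trigSystem d) n ≠ ∞) ∧
    Tendsto (fun n : ℕ =>
        (TrigApprox.nTermWidth (TrigApprox.hMixNorm d s) (TrigApprox.hOneNorm d)
          (TrigApprox.trigSystem d) n).toReal / (n : ℝ) ^ (1 - s))
      atTop
      (𝓝 (((s - 1) / (s - 1 / 2)) ^ (s - 1) * (2 * (d : ℝ)) ^ (s - 1) *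
        (2 * TrigApprox.sSum s + 1) ^ ((s - 1) * ((d : ℝ) - 1)))) ∧
    (∀ n : ℕ, TrigApprox.nTermWidth (TrigApprox.aMixNorm d s) (TrigApprox.hOneNorm d)
      (TrigApprox.trigSystem d) n ≠ ∞) ∧
    Tendsto (fun n : ℕ =>
        (TrigApprox.nTermWidth (TrigApprox.aMixNorm d s) (TrigApprox.hOneNorm d)
          (TrigApprox.trigSystem d) n).toReal / (n : ℝ) ^ (1 / 2 - s))
      atTop
      (𝓝 ((s - 1 / 2) ^ (s - 1 / 2) / (√2 * s ^ (s - 1)) * (2 * (d : ℝ)) ^ (s - 1) *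
        (2 * TrigApprox.sSum s + 1) ^ ((s - 1) * ((d : ℝ) - 1)))) := by
  have : NeZero d := ⟨by omega⟩
  have hd' : (0 : ℝ) < d := by exact_mod_cast hd
  have hS := TrigApprox.sSum_nonneg s
  refine ⟨TrigApprox.summable_sTerm hs,
    TrigApprox.nTermWidth_ne_top TrigApprox.energyWeight_pos
      (TrigApprox.energyWeight_le_mixWeight hs) two_pos le_rfl, ?_,
    TrigApprox.nTermWidth_ne_top TrigApprox.energyWeight_pos
      (TrigApprox.energyWeight_le_mixWeight hs) one_pos one_le_two, ?_⟩
  · have h := TrigApprox.tendsto_mix_nTermWidth hd hs two_pos le_rfl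
    rw [TrigApprox.hMix_constant hs (by positivity) (by positivity)] at h
    refine h.congr fun n => ?_
    rw [show ((s - 1) * 2 + 1 - 2 / 2) / 2 = -(1 - s) by ring, Real.rpow_neg n.cast_nonneg, ← div_eq_mul_inv]
    rfl
  · have h := TrigApprox.tendsto_mix_nTermWidth hd hs one_pos one_le_two
    rw [TrigApprox.aMix_constant hs (by positivity) (by positivity)] at h
    refine h.congr fun n => ?_
    rw [show ((s - 1) * 1 + 1 - 1 / 2) / 1 = -(1 / 2 - s) by ring, Real.rpow_neg n.cast_nonneg, ← div_eq_mul_inv]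
    rfl
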